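/- Let $d\ge 2$, $M\ge 0$ and $N=M+1$. A cloner is a quantum channel (a completely positive, trace preserving linear map) $E$ from operators on $(\mathbb C^d)^{\otimes (N-1)}$ to operators on $(\mathbb C^d)^{\otimes N}$. For $y\subseteq\{1,\dots,N\}$ its fidelity on the sites $y$ is $$F_y(E)=\int \operatorname{Tr}\Big[\Big(\textstyle\bigotimes_{n\in y}|\psi\rangle\langle\psi|\otimes\bigotimes_{n\notin y}\mathbb 1\Big)\,E\big(|\psi\rangle\langle\psi|^{\otimes (N-1)}\big)\Big]\,d\psi ,$$ the average being over a uniformly (Haar) distributed pure state $\psi$ of $\mathbb C^d$; write $F_n(E)=F_{\{n\}}(E)$. The cloner $E$ is called optimal if there is no cloner $E'$ with $F_n(E')\ge F_n(E)$ for all $n$ and strict inequality for some $n$. For a real vector $\beta=(\beta_1,\dots,\beta_N)$ and a basis state $|i\rangle$ of $\mathbb C^d$ let $K_{\beta,i}=d^{-1/2}\sum_n\beta_nV_{n,i}$, where $V_{n,i}$ places the $N-1$ input systems, in order, on the sites other than $n$ and the state $|i\rangle$ on site $n$. Call $\beta$ normalised if $$\Big(\sum_n\beta_n\Big)^2+(d-1)\sum_n\beta_n^2=d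 .$$ For $F\in(-\infty,1]^N$ let $g(F)=\sum_nF_n-\frac1{d-1}\big(\sum_n\sqrt{1-F_n}\big)^2$. Then: 1. For every normalised $\beta$ there is a cloner $E$ with $E(|\psi\rangle\langle\psi|^{\otimes(N-1)})=\sum_iK_{\beta,i}|\psi\rangle\langle\psi|^{\otimes(N-1)}K_{\beta,i}^\dagger$ for every unit vector $\psi$, and $F_y(E)=1-\frac{d-1}{d}\sum_{n\in y}\beta_n^2$ for all $y$; if all $\beta_n\ge0$, then $E$ is optimal. 2. For every optimal cloner $E$ there is a normalised $\beta$ with all $\beta_n\ge 0$ such that $F_k(E)=1-\frac{d-1}{d}\beta_k^2$ for all $k$, and $F_y(E)=1-\frac{d-1}{d}\sum_{n\in y}\beta_n^2=\sum_{n\in y}F_n(E)-|y|+1$ for all $y\subseteq\{1,\dots,N\}$. 3. A vector $F\in\mathbb R^N$ is the vector of single-copy fidelities of an optimal cloner if and only if $F_n\le1$ for all $n$ and $$N-1=\sum_nF_n-\frac1{d-1}\Big(\sum_n\sqrt{1-F_n}\Big)^2 .$$ 4. Let $\Lambda$ be any set of subsets of $\{1,\dots,N\}$ and let $f_y\in\mathbb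 R$ for $y\in\Lambda$ be target fidelities. On the set of all $F\in[0,1]^N$ with $\sum_{n\in y}F_n\ge f_y+|y|-1$ for all $y\in\Lambda$ (which is convex) the function $g$ is convex. There is a cloner $E$ with $F_y(E)\ge f_y$ for all $y\in\Lambda$ if and only if $g$ has a minimum on this set (in particular, the set is non-empty) and this minimum is at most $N-1$. -/

import Mathlib

open scoped BigOperators ComplexConjugate Matrix ComplexOrder
open MeasureTheory

namespace QClone

/-- The computational basis of `(ℂ^d)^{⊗ n}`: strings of length `n` over `{0, …, d-1}`. -/
abbrev Str (d n : ℕ) : Type := Fin n → Fin d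

/-- Operators on `(ℂ^d)^{⊗ n}`, written in the computational basis. -/
abbrev Op (d n : ℕ) : Type := Matrix (Str d n) (Str d n) ℂ

/-- The unit sphere of `ℂ^d`, i.e. the normalised pure states (up to a phase). -/
abbrev PureState (d : ℕ) : Type := Metric.sphere (0 : EuclideanSpace ℂ (Fin d)) 1

/-- The surface measure of the unit sphere of `ℂ^d`. Averaging with respect to it is averaging
over a uniformly distributed (Haar random) pure state. -/
noncomputable def sphereMeasure (d : ℕ) : Measure (PureState d) :=
  (volume : Measure (EuclideanSpace ℂ (Fin d))).toSphere

/-- The ampliation `id_k ⊗ E` of a linear map of operators. -/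
def ampliation {m n : Type*} (E : Matrix m m ℂ →ₗ[ℂ] Matrix n n ℂ) (k : ℕ)
    (X : Matrix (Fin k × m) (Fin k × m) ℂ) : Matrix (Fin k × n) (Fin k × n) ℂ :=
  Matrix.of fun p q => E (Matrix.of fun i j => X (p.1, i) (q.1, j)) p.2 q.2

/-- Quantum channels: completely positive, trace preserving linear maps. -/
structure IsChannel {m n : Type*} [Fintype m] [Fintype n]
    (E : Matrix m m ℂ →ₗ[ℂ] Matrix n n ℂ) : Prop where
  completelyPositive : ∀ (k : ℕ) (X : Matrix (Fin k × m) (Fin k × m) ℂ),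
    X.PosSemidef → (ampliation E k X).PosSemidef
  tracePreserving : ∀ X : Matrix m m ℂ, (E X).trace = X.trace

variable {d : ℕ}

/-- The density operator `(|ψ⟩⟨ψ|)^{⊗ n}` of `n` copies of `ψ`. -/
noncomputable def copies (n : ℕ) (ψ : EuclideanSpace ℂ (Fin d)) : Op d n :=
  Matrix.of fun a b => ∏ j, ψ (a j) * conj (ψ (b j))

/-- The operator `|ψ⟩⟨ψ|` on every site of `y`, tensored with the identity on the other sites. -/
noncomputable def siteProj {n : ℕ} (y : Finset (Fin n)) (ψ : EuclideanSpace ℂ (Fin d)) :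
    Op d n :=
  Matrix.of fun a b => ∏ j,
    if j ∈ y then ψ (a j) * conj (ψ (b j)) else if a j = b j then 1 else 0

/-- The fidelity of the output clones at the sites of `y`, for the map `E` acting on `M` copies of
a uniformly random pure state. -/
noncomputable def fidelity {M N : ℕ} (E : Op d M →ₗ[ℂ] Op d N) (y : Finset (Fin N)) : ℝ :=
  ⨍ ψ : PureState d, (siteProj y ψ.1 * E (copies M ψ.1)).trace.re ∂(sphereMeasure d)

/-- An `M → N` cloning channel is optimal if no channel has single-copy fidelities that are all at
least as large, one of them being strictly larger. -/
def IsOptimalCloner {M N : ℕ} (E : Op d M →ₗ[ℂ] Op d N) : Prop :=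
  IsChannel E ∧ ∀ E' : Op d M →ₗ[ℂ] Op d N, IsChannel E' →
    (∀ n, fidelity E {n} ≤ fidelity E' {n}) → ∀ n, fidelity E' {n} ≤ fidelity E {n}

/-- Target fidelities `f y`, `y ∈ Λ`, are achievable if some `M → N` cloning channel has
fidelities at least as large. -/
def Achievable (d M N : ℕ) (Λ : Set (Finset (Fin N))) (f : Finset (Fin N) → ℝ) : Prop :=
  ∃ E : Op d M →ₗ[ℂ] Op d N, IsChannel E ∧ ∀ y ∈ Λ, f y ≤ fidelity E y

/-- The operator `d^{-1/2} ∑ₙ βₙ Vₙ` from `M` to `M + 1` sites, where `Vₙ` puts the `M` inputs on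
the sites other than `n` (in order) and the basis state `|i⟩` on site `n`. -/
noncomputable def clonerKraus {M : ℕ} (β : Fin (M + 1) → ℝ) (i : Fin d) :
    Matrix (Str d (M + 1)) (Str d M) ℂ :=
  Matrix.of fun b a =>
    (((Real.sqrt d)⁻¹ * ∑ n, if b n = i ∧ n.removeNth b = a then β n else 0 : ℝ) : ℂ)

/-- The output, on `M` copies of `ψ`, of the cloner with amplitudes `β` and with the leftover site
maximally mixed. -/
noncomputable def clonerOutput {M : ℕ} (β : Fin (M + 1) → ℝ) (ψ : EuclideanSpace ℂ (Fin d)) :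
    Op d (M + 1) :=
  ∑ i : Fin d, clonerKraus β i * copies M ψ * (clonerKraus β i)ᴴ

/-- The normalisation condition on the amplitudes. -/
def Normalised (d : ℕ) {N : ℕ} (β : Fin N → ℝ) : Prop :=
  (∑ n, β n) ^ 2 + ((d : ℝ) - 1) * ∑ n, β n ^ 2 = d

/-- `∑ₙ Fₙ - (∑ₙ √(1 - Fₙ))² / (d - 1)`. -/
noncomputable def tradeOff (d : ℕ) {N : ℕ} (F : Fin N → ℝ) : ℝ :=
  ∑ n, F n - 1 / ((d : ℝ) - 1) * (∑ n, Real.sqrt (1 - F n)) ^ 2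

/-- The vectors `F ∈ [0,1]^N` with `y · F ≥ f y + |y| - 1` for all `y ∈ Λ`. -/
def feasibleSet {N : ℕ} (Λ : Set (Finset (Fin N))) (f : Finset (Fin N) → ℝ) :
    Set (Fin N → ℝ) :=
  {F | (∀ n, 0 ≤ F n ∧ F n ≤ 1) ∧ ∀ y ∈ Λ, f y + (y.card : ℝ) - 1 ≤ ∑ n ∈ y, F n}

end QClone

namespace QClone

/-! ### Gaussian moments on the complex plane -/

section Gaussian

/-! Upper bound. Write a channel in Kraus form. For each Kraus operator `K`, the overlap `P(ψ) =
⟨ψ^{⊗N}, K ψ^{⊗M}⟩` is a polynomial of degree `M` in `ψ` and `M + 1` in its conjugate. The mean of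
`∑ |P|²` over the Kraus operators is the probability `p_∅` that no clone is wrong. Differentiating
`P` in the conjugate variables strikes out one output site at a time; the component of this gradient
orthogonal to `ψ` is a sum over `n` of vectors whose mean squared norms, summed over the Kraus
operators, are the probabilities `p_{n}` that exactly clone `n` is wrong. A spectral gap on the
sphere (`spectral_gap`) bounds the tangential gradient below by `(d - 1) ∫ |P|²`, and Minkowski's
inequality bounds it above, whence `(d - 1) p_∅ ≤ (∑ √p_{n})²` (`errProb_empty_le`).

Let `q_n` be the probability that `n` is the first wrong site. Then `q_n ≥ p_{n}`, the `q_n` sum to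
`1 - p_∅`, and their sum over `y` is at most `1 - F_y`. So `x_n = √(d q_n / (d - 1))` satisfies the
normalisation condition with `≥`, and shrinking `x` gives a normalised `β` whose fidelities dominate
those of the channel at all `y` simultaneously (`IsChannel.exists_normalised`).

Attainment. The operators `K_{β,i}` resolve the identity on the symmetric subspace exactly when `β`
is normalised; completing them on its complement gives a channel, and its fidelities are computed
directly (`exists_cloner_fidelity`).

Consequences. Optimal cloners must attain the single-site bounds, and the union bound then fixes
their joint fidelities. In the variables `F_n` the normalisation condition is the trade-off equation
(`tradeOff_of_amplitudes`). Convexity of the trade-off function is Cauchy–Schwarz for square roots,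
and the minimum exists by compactness. -/

theorem integrable_pow_mul_conj_pow_mul_exp (p q : ℕ) :
    Integrable fun z : ℂ => z ^ p * conj z ^ q * (Real.exp (-‖z‖ ^ 2) : ℂ) := by
  have h : Integrable fun z : ℂ => (fun r : ℝ => r ^ (p + q) * Real.exp (-r ^ 2)) ‖z‖ := by
    rw [integrable_fun_norm_addHaar volume
      (f := fun r : ℝ => r ^ (p + q) * Real.exp (-r ^ 2))]
    have := integrableOn_rpow_mul_exp_neg_mul_sq (b := 1) one_pos (s := ((p + q + 1 : ℕ) : ℝ))
      (by have : (0 : ℝ) ≤ ((p + q + 1 : ℕ) : ℝ) := by positivity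
          linarith)
    refine this.congr_fun (fun x hx => ?_) measurableSet_Ioi
    simp only [Real.rpow_natCast, Complex.finrank_real_complex, smul_eq_mul]
    ring_nf
  refine h.mono' (by fun_prop) (Filter.Eventually.of_forall fun z => ?_)
  rw [norm_mul, norm_mul, norm_pow, norm_pow, RCLike.norm_conj, Complex.norm_real,
    Real.norm_of_nonneg (Real.exp_pos _).le, ← pow_add]

/-- Equal exponents reduce to a radial Gamma integral. Unequal exponents vanish because the Gaussian
measure is rotation invariant while the integrand picks up a nontrivial phase. -/
theorem integral_pow_mul_conj_pow_mul_exp (p q : ℕ) :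
    ∫ z : ℂ, z ^ p * conj z ^ q * (Real.exp (-‖z‖ ^ 2) : ℂ) =
      if p = q then (Real.pi * p.factorial : ℂ) else 0 := by
  split_ifs with h
  · subst h
    have h1 : ∀ z : ℂ, z ^ p * conj z ^ p * (Real.exp (-‖z‖ ^ 2) : ℂ) =
        ((‖z‖ ^ ((2 * p : ℕ) : ℝ) * Real.exp (-‖z‖ ^ (2 : ℝ)) : ℝ) : ℂ) := fun z => by
      rw [← mul_pow, Complex.mul_conj, Complex.normSq_eq_norm_sq, Real.rpow_natCast,
        Real.rpow_two]
      push_cast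
      ring
    simp_rw [h1]
    rw [integral_complex_ofReal, Complex.integral_rpow_mul_exp_neg_rpow (by norm_num)
      (by have : (0 : ℝ) ≤ ((2 * p : ℕ) : ℝ) := by positivity
          linarith)]
    have h2 : (((2 * p : ℕ) : ℝ) + 2) / 2 = p + 1 := by push_cast; ring
    rw [h2, Real.Gamma_nat_eq_factorial]
    push_cast
    ring
  · set I := ∫ z : ℂ, z ^ p * conj z ^ q * (Real.exp (-‖z‖ ^ 2) : ℂ) with hI
    have key : ∀ c : Circle, I = (c : ℂ) ^ p * conj (c : ℂ) ^ q * I := fun c => by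
      conv_lhs => rw [hI, ← (rotation c).measurePreserving.integral_comp'
        (f := (rotation c).toMeasurableEquiv)]
      rw [hI, ← integral_const_mul]
      refine integral_congr_ae (Filter.Eventually.of_forall fun z => ?_)
      have hz : ‖rotation c z‖ = ‖z‖ := (rotation c).norm_map z
      simp only [LinearIsometryEquiv.coe_toMeasurableEquiv]
      rw [hz]
      simp only [rotation_apply, map_mul, mul_pow]
      ring
    obtain ⟨c, hc⟩ : ∃ c : Circle, (c : ℂ) ^ p * conj (c : ℂ) ^ q ≠ 1 := by
      by_contra! hall
      -- Rotation by one radian suffices: a trivial phase means `p - q = 2πn`, which for `n ≠ 0`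
      -- would make `π` rational.
      have h1 := hall (Circle.exp 1)
      rw [← Circle.coe_inv_eq_conj, Circle.coe_exp, Circle.coe_inv, Circle.coe_exp,
        ← Complex.exp_neg, ← Complex.exp_nat_mul, ← Complex.exp_nat_mul, ← Complex.exp_add,
        Complex.exp_eq_one_iff] at h1
      obtain ⟨n, hn⟩ := h1
      have h2 : ((p : ℝ) - q) = n * (2 * Real.pi) := by
        have := congrArg Complex.im hn
        simpa [sub_eq_add_neg] using this
      by_cases hn0 : n = 0
      · rw [hn0] at h2
        apply h
        have : (p : ℝ) = q := by simpa [sub_eq_zero] using h2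
        exact_mod_cast this
      · refine irrational_pi ⟨((p : ℚ) - q) / (2 * n), ?_⟩
        have : (n : ℝ) ≠ 0 := by exact_mod_cast hn0
        push_cast
        field_simp
        linarith
    by_contra hne
    exact hc (mul_right_cancel₀ hne (by rw [one_mul]; exact (key c).symm))

end Gaussian

/-! ### Polynomials in `z` and its conjugate, and Gaussian integration by parts -/

section Polynomials

open MvPolynomial

variable {d : ℕ}

/-- Polynomials in the coordinates of a vector of `ℂ^d` and their complex conjugates. -/
abbrev CPoly (d : ℕ) : Type := MvPolynomial (Fin d ⊕ Fin d) ℂ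

/-- Evaluation of a polynomial in `z` and its conjugate. -/
noncomputable def cEval (z : EuclideanSpace ℂ (Fin d)) : CPoly d →+* ℂ :=
  eval (Sum.elim (fun j => z j) (fun j => conj (z j)))

@[simp] theorem cEval_X_inl (z : EuclideanSpace ℂ (Fin d)) (j : Fin d) :
    cEval z (X (Sum.inl j)) = z j := by simp [cEval]

@[simp] theorem cEval_X_inr (z : EuclideanSpace ℂ (Fin d)) (j : Fin d) :
    cEval z (X (Sum.inr j)) = conj (z j) := by simp [cEval]

@[simp] theorem cEval_C (z : EuclideanSpace ℂ (Fin d)) (c : ℂ) :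
    cEval z (C c) = c := by simp [cEval]

theorem continuous_cEval (P : CPoly d) :
    Continuous fun z : EuclideanSpace ℂ (Fin d) => cEval z P := by
  induction P using MvPolynomial.induction_on with
  | C a => simpa using continuous_const
  | add p q hp hq => simp only [map_add]; exact hp.add hq
  | mul_X p i hp =>
    cases i with
    | inl j => simp only [map_mul, cEval_X_inl]; fun_prop
    | inr j => simp only [map_mul, cEval_X_inr]; fun_prop

theorem cEval_monomial (z : EuclideanSpace ℂ (Fin d)) (m : Fin d ⊕ Fin d →₀ ℕ) (c : ℂ) :
    cEval z (monomial m c) =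
      c * ∏ j, (z j ^ m (Sum.inl j) * conj (z j) ^ m (Sum.inr j)) := by
  rw [cEval, eval_monomial, Finsupp.prod_fintype _ _ (by simp), Fintype.prod_sum_type,
    Finset.prod_mul_distrib]
  simp

theorem cEval_smul_of_isHomogeneous {P : CPoly d} {n : ℕ} (hP : P.IsHomogeneous n) (r : ℝ)
    (z : EuclideanSpace ℂ (Fin d)) : cEval (r • z) P = (r : ℂ) ^ n * cEval z P := by
  have h : ∀ m ∈ P.support, cEval (r • z) (monomial m (coeff m P)) =
      (r : ℂ) ^ n * cEval z (monomial m (coeff m P)) := fun m hm => by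
    have hdeg := hP (mem_support_iff.mp hm)
    rw [Finsupp.weight_apply, Finsupp.sum_fintype _ _ (by simp), Fintype.sum_sum_type] at hdeg
    simp only [Pi.one_apply, smul_eq_mul, mul_one] at hdeg
    rw [cEval_monomial, cEval_monomial, ← hdeg, pow_add, ← Finset.prod_pow_eq_pow_sum,
      ← Finset.prod_pow_eq_pow_sum, mul_left_comm, ← Finset.prod_mul_distrib,
      ← Finset.prod_mul_distrib]
    congr 1
    refine Finset.prod_congr rfl fun j _ => ?_
    simp only [PiLp.smul_apply, Complex.real_smul, map_mul, Complex.conj_ofReal, mul_pow]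
    ring
  conv_lhs => rw [P.as_sum]
  conv_rhs => rw [P.as_sum]
  rw [map_sum, map_sum, Finset.mul_sum]
  exact Finset.sum_congr rfl h

theorem exp_neg_norm_sq (z : EuclideanSpace ℂ (Fin d)) :
    (Real.exp (-‖z‖ ^ 2) : ℂ) = ∏ j, (Real.exp (-‖z j‖ ^ 2) : ℂ) := by
  rw [EuclideanSpace.norm_sq_eq, ← Finset.sum_neg_distrib, Real.exp_sum]
  push_cast
  rfl

/-- Lebesgue measure on `ℂ^d` is, up to a constant, the product of the Lebesgue measures of the
coordinates. -/
theorem exists_map_ofLp_volume (d : ℕ) : ∃ c : NNReal,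
    Measure.map (EuclideanSpace.equiv (Fin d) ℂ) volume =
      c • (volume : Measure (Fin d → ℂ)) := by
  set e : EuclideanSpace ℂ (Fin d) ≃L[ℝ] (Fin d → ℂ) :=
    PiLp.continuousLinearEquiv 2 ℝ fun _ : Fin d => ℂ
  have : (Measure.map e (volume : Measure (EuclideanSpace ℂ (Fin d)))).IsAddHaarMeasure :=
    e.isAddHaarMeasure_map _
  exact ⟨_, Measure.isAddLeftInvariant_eq_smul (Measure.map e volume) volume⟩

theorem integrable_cEval_mul_exp (P : CPoly d) :
    Integrable fun z : EuclideanSpace ℂ (Fin d) => cEval z P * (Real.exp (-‖z‖ ^ 2) : ℂ) := by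
  induction P using MvPolynomial.induction_on' with
  | add p q hp hq => simp only [map_add, add_mul]; exact hp.add hq
  | monomial m a =>
    obtain ⟨c, hc⟩ := exists_map_ofLp_volume d
    have h1 : Integrable (fun x : Fin d → ℂ => a * ∏ j, (x j ^ m (Sum.inl j) *
        conj (x j) ^ m (Sum.inr j) * (Real.exp (-‖x j‖ ^ 2) : ℂ)))
        (Measure.map (EuclideanSpace.equiv (Fin d) ℂ) volume) := by
      rw [hc]
      refine Integrable.smul_measure_nnreal (Integrable.const_mul ?_ a)
      exact Integrable.fintype_prod (f := fun j (x : ℂ) => x ^ m (Sum.inl j) *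
        conj x ^ m (Sum.inr j) * (Real.exp (-‖x‖ ^ 2) : ℂ))
        fun j => integrable_pow_mul_conj_pow_mul_exp _ _
    have h2 := h1.comp_measurable (EuclideanSpace.equiv (Fin d) ℂ).continuous.measurable
    refine h2.congr (Filter.Eventually.of_forall fun z => ?_)
    simp only [Function.comp]
    rw [cEval_monomial, exp_neg_norm_sq, Finset.prod_mul_distrib, mul_assoc]
    rfl

/-- The Gaussian integral of a polynomial in `z` and its conjugate. -/
noncomputable def gaussInt (d : ℕ) : CPoly d →ₗ[ℂ] ℂ where
  toFun P := ∫ z : EuclideanSpace ℂ (Fin d), cEval z P * (Real.exp (-‖z‖ ^ 2) : ℂ)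
  map_add' P Q := by
    simp only [map_add, add_mul]
    exact integral_add (integrable_cEval_mul_exp P) (integrable_cEval_mul_exp Q)
  map_smul' c P := by
    simp only [smul_eq_C_mul, map_mul, cEval_C, mul_assoc, RingHom.id_apply, smul_eq_mul]
    exact integral_const_mul _ _

/-- The Gaussian and Lebesgue measure factor over coordinates. The constant comes from uniqueness of
Haar measure and need not be identified, since it is used only in identities linear in it. -/
theorem exists_gaussInt_monomial (d : ℕ) : ∃ c : ℂ, ∀ m : Fin d ⊕ Fin d →₀ ℕ,
    gaussInt d (monomial m 1) = c * ∏ j, if m (Sum.inl j) = m (Sum.inr j) then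
      (Real.pi * (m (Sum.inl j)).factorial : ℂ) else 0 := by
  obtain ⟨c, hc⟩ := exists_map_ofLp_volume d
  refine ⟨c, fun m => ?_⟩
  have h1 : gaussInt d (monomial m 1) = ∫ x : Fin d → ℂ, ∏ j, (x j ^ m (Sum.inl j) *
        conj (x j) ^ m (Sum.inr j) * (Real.exp (-‖x j‖ ^ 2) : ℂ))
        ∂(Measure.map (EuclideanSpace.equiv (Fin d) ℂ) volume) := by
    rw [integral_map (EuclideanSpace.equiv (Fin d) ℂ).continuous.measurable.aemeasurable
      (by fun_prop)]
    refine integral_congr_ae (Filter.Eventually.of_forall fun z => ?_)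
    simp only
    rw [cEval_monomial, exp_neg_norm_sq, one_mul, Finset.prod_mul_distrib (ι := Fin d)
      (g := fun j => (Real.exp (-‖_‖ ^ 2) : ℂ))]
    rfl
  rw [h1, hc, integral_smul_nnreal_measure, integral_fintype_prod_volume_eq_prod
    (fun j (x : ℂ) => x ^ m (Sum.inl j) * conj x ^ m (Sum.inr j) * (Real.exp (-‖x‖ ^ 2) : ℂ))]
  simp_rw [integral_pow_mul_conj_pow_mul_exp]
  rfl

/-- Integration by parts: the `z_k`-derivative of `exp(-‖z‖²)` is `-conj z_k` times itself. On
monomials it amounts to the recursion `(p + 1)! = (p + 1) p!` in the factor at `k`, so no boundary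
terms have to be discussed. -/
theorem gaussInt_pderiv_inl (k : Fin d) (P : CPoly d) :
    gaussInt d (pderiv (Sum.inl k) P) = gaussInt d (X (Sum.inr k) * P) := by
  obtain ⟨c, hc⟩ := exists_gaussInt_monomial d
  induction P using MvPolynomial.induction_on' with
  | add p q hp hq => simp only [map_add, mul_add, hp, hq]
  | monomial m a =>
    have h1 : pderiv (Sum.inl k) (monomial m a) =
        (a * m (Sum.inl k)) • monomial (m - Finsupp.single (Sum.inl k) 1) (1 : ℂ) := by
      rw [pderiv_monomial, smul_monomial, smul_eq_mul, mul_one]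
    have h2 : (X (Sum.inr k) * monomial m a : CPoly d) =
        a • monomial (Finsupp.single (Sum.inr k) 1 + m) (1 : ℂ) := by
      rw [X, monomial_mul, smul_monomial, smul_eq_mul, mul_one, one_mul]
    rw [h1, h2, map_smul, map_smul, hc, hc, ← Finset.mul_prod_erase _ _ (Finset.mem_univ k),
      ← Finset.mul_prod_erase _ _ (Finset.mem_univ k), smul_eq_mul, smul_eq_mul, mul_assoc,
      mul_left_comm (m (Sum.inl k) : ℂ) c, ← mul_assoc (m (Sum.inl k) : ℂ)]
    congr 3
    -- For exponent zero the subtraction of exponents truncates, but the coefficient `m (Sum.inl k)`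
    -- kills the left side, and on the right the two exponents at `k` cannot match.
    · rcases hm : m (Sum.inl k) with _ | p
      · have : ¬ (0 = 1 + m (Sum.inr k)) := by omega
        simp [hm, this]
      · by_cases hp : p = m (Sum.inr k)
        · simp [hm, ← hp, Nat.factorial_succ, add_comm 1 p]
          ring
        · have : ¬ (p + 1 = 1 + m (Sum.inr k)) := by omega
          simp [hm, hp, this]
    · refine Finset.prod_congr rfl fun j hj => ?_
      have hj' : k ≠ j := (Finset.ne_of_mem_erase hj).symm
      simp [hj']

theorem gaussInt_pderiv_inr (k : Fin d) (P : CPoly d) :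
    gaussInt d (pderiv (Sum.inr k) P) = gaussInt d (X (Sum.inl k) * P) := by
  obtain ⟨c, hc⟩ := exists_gaussInt_monomial d
  induction P using MvPolynomial.induction_on' with
  | add p q hp hq => simp only [map_add, mul_add, hp, hq]
  | monomial m a =>
    have h1 : pderiv (Sum.inr k) (monomial m a) =
        (a * m (Sum.inr k)) • monomial (m - Finsupp.single (Sum.inr k) 1) (1 : ℂ) := by
      rw [pderiv_monomial, smul_monomial, smul_eq_mul, mul_one]
    have h2 : (X (Sum.inl k) * monomial m a : CPoly d) =
        a • monomial (Finsupp.single (Sum.inl k) 1 + m) (1 : ℂ) := by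
      rw [X, monomial_mul, smul_monomial, smul_eq_mul, mul_one, one_mul]
    rw [h1, h2, map_smul, map_smul, hc, hc, ← Finset.mul_prod_erase _ _ (Finset.mem_univ k),
      ← Finset.mul_prod_erase _ _ (Finset.mem_univ k), smul_eq_mul, smul_eq_mul, mul_assoc,
      mul_left_comm (m (Sum.inr k) : ℂ) c, ← mul_assoc (m (Sum.inr k) : ℂ)]
    congr 3
    · rcases hm : m (Sum.inr k) with _ | p
      · simp [hm]
      · by_cases hp : m (Sum.inl k) = p
        · simp [hm, hp, Nat.factorial_succ, add_comm 1 p]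
          ring
        · have : ¬ (1 + m (Sum.inl k) = p + 1) := by omega
          simp [hm, hp, this]
    · refine Finset.prod_congr rfl fun j hj => ?_
      have hj' : k ≠ j := (Finset.ne_of_mem_erase hj).symm
      simp [hj']

end Polynomials

/-! ### From Gaussian integrals to the unit sphere -/

section Sphere

open MvPolynomial

variable {d : ℕ}

theorem finrank_real_euclideanSpace_complex (d : ℕ) :
    Module.finrank ℝ (EuclideanSpace ℂ (Fin d)) = 2 * d := by
  rw [finrank_real_of_complex, finrank_euclideanSpace_fin]

instance : IsFiniteMeasure (sphereMeasure d) := by unfold sphereMeasure; infer_instance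

theorem nontrivial_euclideanSpace (hd : 2 ≤ d) : Nontrivial (EuclideanSpace ℂ (Fin d)) := by
  have : NeZero d := ⟨by omega⟩
  infer_instance

theorem sphereMeasure_ne_zero (hd : 2 ≤ d) : sphereMeasure d ≠ 0 := by
  have := nontrivial_euclideanSpace hd
  exact Measure.toSphere_ne_zero _

/-- Integration in polar coordinates of a homogeneous function against a Gaussian weight. -/
theorem integral_homogeneous_mul_exp (hd : 2 ≤ d) (h : EuclideanSpace ℂ (Fin d) → ℂ) (n : ℕ)
    (hh : ∀ (r : ℝ) z, h (r • z) = (r : ℂ) ^ n * h z) :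
    ∫ z, h z * (Real.exp (-‖z‖ ^ 2) : ℂ) =
      (∫ ψ, h ψ.1 ∂sphereMeasure d) *
        ((Real.Gamma ((n + 2 * d : ℝ) / 2) / 2 : ℝ) : ℂ) := by
  have := nontrivial_euclideanSpace hd
  calc ∫ z, h z * (Real.exp (-‖z‖ ^ 2) : ℂ)
      = ∫ x : ({(0)}ᶜ : Set (EuclideanSpace ℂ (Fin d))), h x.1 * (Real.exp (-‖x.1‖ ^ 2) : ℂ)
          ∂((volume : Measure (EuclideanSpace ℂ (Fin d))).comap (↑)) := by
        rw [integral_subtype_comap (measurableSet_singleton _).compl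
          fun x : EuclideanSpace ℂ (Fin d) => h x * (Real.exp (-‖x‖ ^ 2) : ℂ), restrict_compl_singleton]
    _ = ∫ x : PureState d × Set.Ioi (0 : ℝ),
          h x.1.1 * (((x.2 : ℝ) : ℂ) ^ n * (Real.exp (-(x.2 : ℝ) ^ 2) : ℂ))
          ∂((sphereMeasure d).prod (.volumeIoiPow (Module.finrank ℝ (EuclideanSpace ℂ (Fin d)) - 1))) := by
        rw [sphereMeasure, ← (volume : Measure (EuclideanSpace ℂ (Fin d))).measurePreserving_homeomorphUnitSphereProd.integral_comp
          (Homeomorph.measurableEmbedding _)]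
        refine integral_congr_ae (Filter.Eventually.of_forall fun x => ?_)
        have hx : ‖x.1‖ ≠ 0 := norm_ne_zero_iff.mpr x.2
        have h1 : x.1 = ‖x.1‖ • (‖x.1‖⁻¹ • x.1) := by rw [smul_smul, mul_inv_cancel₀ hx, one_smul]
        simp only [homeomorphUnitSphereProd_apply_fst_coe, homeomorphUnitSphereProd_apply_snd_coe]
        conv_lhs => rw [h1, hh, ← h1]
        ring
    _ = (∫ ψ, h ψ.1 ∂sphereMeasure d) * ∫ r : Set.Ioi (0 : ℝ),
          (((r : ℝ) : ℂ) ^ n * (Real.exp (-(r : ℝ) ^ 2) : ℂ))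
            ∂(.volumeIoiPow (Module.finrank ℝ (EuclideanSpace ℂ (Fin d)) - 1)) :=
        integral_prod_mul (fun ψ : PureState d => h ψ.1) fun r : Set.Ioi (0 : ℝ) =>
          (((r : ℝ) : ℂ) ^ n * (Real.exp (-(r : ℝ) ^ 2) : ℂ))
    _ = _ := by
      congr 1
      simp only [Measure.volumeIoiPow, ENNReal.ofReal]
      rw [integral_withDensity_eq_integral_smul
          (measurable_subtype_coe.pow_const _).real_toNNReal,
        integral_subtype_comap measurableSet_Ioi fun a : ℝ =>
          Real.toNNReal (a ^ (Module.finrank ℝ (EuclideanSpace ℂ (Fin d)) - 1)) •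
            ((a : ℂ) ^ n * (Real.exp (-a ^ 2) : ℂ)),
        setIntegral_congr_fun measurableSet_Ioi (g := fun a : ℝ =>
          ((a ^ ((n + 2 * d - 1 : ℝ)) * Real.exp (-a ^ (2 : ℝ)) : ℝ) : ℂ)) fun x hx => ?_]
      · rw [integral_complex_ofReal, integral_rpow_mul_exp_neg_rpow (by norm_num)]
        · congr 1
          rw [sub_add_cancel]
          ring
        · have : (2 : ℝ) ≤ d := by exact_mod_cast hd
          have : (0 : ℝ) ≤ n := by positivity
          linarith
      · have h1 : (n + 2 * d - 1 : ℝ) = ((n + (2 * d - 1) : ℕ) : ℝ) := by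
          rw [Nat.cast_add, Nat.cast_sub (by omega)]
          push_cast
          ring
        simp only
        rw [NNReal.smul_def, Real.coe_toNNReal _ (pow_nonneg hx.out.le _),
          finrank_real_euclideanSpace_complex, h1, Real.rpow_natCast, Real.rpow_two, pow_add,
          Complex.real_smul]
        push_cast
        ring

/-- In real dimension `2d` the radial integral for degree `2n` is `Γ(n + d) / 2`. Hence Gaussian
identities between homogeneous polynomials pass to the sphere, at the cost of a ratio of factorials.
-/
theorem gaussInt_eq_sphere (hd : 2 ≤ d) {P : CPoly d} {n : ℕ} (hP : P.IsHomogeneous (2 * n)) :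
    gaussInt d P = (∫ ψ, cEval ψ.1 P ∂sphereMeasure d) *
      (((n + d - 1).factorial / 2 : ℝ) : ℂ) := by
  have h := integral_homogeneous_mul_exp hd (fun z => cEval z P) (2 * n)
    fun r z => cEval_smul_of_isHomogeneous hP r z
  have h2 : (((2 * n : ℕ) : ℝ) + 2 * d) / 2 = ((n + d - 1 : ℕ) : ℝ) + 1 := by
    rw [Nat.cast_sub (by omega)]
    push_cast
    ring
  rw [h2, Real.Gamma_nat_eq_factorial] at h
  exact h

/-- Integration by parts on the sphere. -/
theorem integral_sphere_pderiv_inl (hd : 2 ≤ d) {k : Fin d} {P : CPoly d} {n : ℕ}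
    (hP : P.IsHomogeneous (2 * n + 1)) :
    ∫ ψ, cEval ψ.1 (pderiv (Sum.inl k) P) ∂sphereMeasure d =
      (n + d) * ∫ ψ, cEval ψ.1 (X (Sum.inr k) * P) ∂sphereMeasure d := by
  have h1 := gaussInt_eq_sphere hd (n := n) (P := pderiv (Sum.inl k) P) hP.pderiv
  have h2 := gaussInt_eq_sphere hd (n := n + 1) (P := X (Sum.inr k) * P) (by
    convert (isHomogeneous_X ℂ (Sum.inr k)).mul hP using 1; ring)
  rw [gaussInt_pderiv_inl, h2] at h1
  have h3 : n + 1 + d - 1 = (n + d - 1) + 1 := by omega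
  have h4 : (((n + d - 1 : ℕ) : ℂ) + 1) = n + d := by
    rw [Nat.cast_sub (by omega)]; push_cast; ring
  have h5 : (((n + d - 1).factorial : ℝ) : ℂ) ≠ 0 := by
    exact_mod_cast Nat.factorial_ne_zero _
  -- The two sides of the Gaussian identity have degrees `2n` and `2n + 2`; the quotient of their
  -- radial factors is `n + d`.
  rw [h3, Nat.factorial_succ] at h1
  push_cast at h1 h5
  rw [h4] at h1
  refine mul_right_cancel₀ h5 ?_
  linear_combination -2 * h1

/-- Integration by parts on the sphere. -/
theorem integral_sphere_pderiv_inr (hd : 2 ≤ d) {k : Fin d} {P : CPoly d} {n : ℕ}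
    (hP : P.IsHomogeneous (2 * n + 1)) :
    ∫ ψ, cEval ψ.1 (pderiv (Sum.inr k) P) ∂sphereMeasure d =
      (n + d) * ∫ ψ, cEval ψ.1 (X (Sum.inl k) * P) ∂sphereMeasure d := by
  have h1 := gaussInt_eq_sphere hd (n := n) (P := pderiv (Sum.inr k) P) hP.pderiv
  have h2 := gaussInt_eq_sphere hd (n := n + 1) (P := X (Sum.inl k) * P) (by
    convert (isHomogeneous_X ℂ (Sum.inl k)).mul hP using 1; ring)
  rw [gaussInt_pderiv_inr, h2] at h1
  have h3 : n + 1 + d - 1 = (n + d - 1) + 1 := by omega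
  have h4 : (((n + d - 1 : ℕ) : ℂ) + 1) = n + d := by
    rw [Nat.cast_sub (by omega)]; push_cast; ring
  have h5 : (((n + d - 1).factorial : ℝ) : ℂ) ≠ 0 := by
    exact_mod_cast Nat.factorial_ne_zero _
  rw [h3, Nat.factorial_succ] at h1
  push_cast at h1 h5
  rw [h4] at h1
  refine mul_right_cancel₀ h5 ?_
  linear_combination -2 * h1

end Sphere

/-! ### The spectral gap of the antiholomorphic tangential derivative -/

section SpectralGap

open MvPolynomial

variable {d : ℕ}

theorem integrable_sphere_of_continuous {F : Type*} [NormedAddCommGroup F]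
    {f : PureState d → F} (hf : Continuous f) : Integrable f (sphereMeasure d) :=
  hf.integrable_of_hasCompactSupport (HasCompactSupport.of_compactSpace f)

theorem continuous_cEval_sphere (P : CPoly d) :
    Continuous fun ψ : PureState d => cEval ψ.1 P :=
  (continuous_cEval P).comp continuous_subtype_val

theorem integrable_cEval_sphere (P : CPoly d) :
    Integrable (fun ψ : PureState d => cEval ψ.1 P) (sphereMeasure d) :=
  integrable_sphere_of_continuous (continuous_cEval_sphere P)

/-- Complex conjugation of polynomials. -/
noncomputable def conjPoly : CPoly d →+* CPoly d :=
  (rename (Sum.swap : Fin d ⊕ Fin d → Fin d ⊕ Fin d)).toRingHom.comp (map (starRingEnd ℂ))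

theorem cEval_conjPoly (z : EuclideanSpace ℂ (Fin d)) (P : CPoly d) :
    cEval z (conjPoly P) = conj (cEval z P) := by
  induction P using MvPolynomial.induction_on with
  | C a => simp [conjPoly, cEval]
  | add p q hp hq => simp [hp, hq]
  | mul_X p i hp =>
    rw [map_mul, map_mul, hp, map_mul, map_mul]
    cases i <;> simp [conjPoly, cEval]

theorem pderiv_inl_conjPoly (k : Fin d) (P : CPoly d) :
    pderiv (Sum.inl k) (conjPoly P) = conjPoly (pderiv (Sum.inr k) P) := by
  have h := pderiv_rename (f := (Sum.swap : Fin d ⊕ Fin d → Fin d ⊕ Fin d))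
    Sum.swap_leftInverse.injective (Sum.inr k) (map (starRingEnd ℂ) P)
  rw [pderiv_map] at h
  exact h

theorem pderiv_inr_conjPoly (k : Fin d) (P : CPoly d) :
    pderiv (Sum.inr k) (conjPoly P) = conjPoly (pderiv (Sum.inl k) P) := by
  have h := pderiv_rename (f := (Sum.swap : Fin d ⊕ Fin d → Fin d ⊕ Fin d))
    Sum.swap_leftInverse.injective (Sum.inl k) (map (starRingEnd ℂ) P)
  rw [pderiv_map] at h
  exact h

theorem isHomogeneous_conjPoly {P : CPoly d} {n : ℕ} (hP : P.IsHomogeneous n) :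
    (conjPoly P).IsHomogeneous n :=
  IsHomogeneous.rename_isHomogeneous (hP.map _)

theorem pderiv_comm {σ : Type*} (i j : σ) (P : MvPolynomial σ ℂ) :
    pderiv i (pderiv j P) = pderiv j (pderiv i P) := by
  classical
  induction P using MvPolynomial.induction_on with
  | C a => simp
  | add p q hp hq => simp [hp, hq]
  | mul_X p k hp =>
    simp only [pderiv_mul, map_add, hp, pderiv_X, Pi.single_apply]
    split_ifs <;> simp <;> ring

theorem sum_conj_mul_self {ψ : EuclideanSpace ℂ (Fin d)} (hψ : ‖ψ‖ = 1) :
    ∑ k, conj (ψ k) * ψ k = 1 := by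
  have h : ∑ k, ‖ψ k‖ ^ 2 = 1 := by rw [← EuclideanSpace.norm_sq_eq, hψ, one_pow]
  simp_rw [Complex.conj_mul']
  exact_mod_cast h

/-- Pythagoras: the part of `u` orthogonal to the unit vector `v`. -/
theorem sum_norm_sq_sub {u v : Fin d → ℂ} (hv : ∑ k, conj (v k) * v k = 1) {c : ℂ}
    (hu : ∑ k, conj (v k) * u k = c) :
    ∑ k, ‖u k - v k * c‖ ^ 2 = ∑ k, ‖u k‖ ^ 2 - ‖c‖ ^ 2 := by
  have hu' : ∑ k, v k * conj (u k) = conj c := by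
    rw [← hu, map_sum]
    simp
  have h : ∑ k, conj (u k - v k * c) * (u k - v k * c) =
      ∑ k, conj (u k) * u k - conj c * c := by
    calc _ = ∑ k, (conj (u k) * u k - v k * conj (u k) * c - conj c * (conj (v k) * u k) +
          conj c * c * (conj (v k) * v k)) := by
          refine Finset.sum_congr rfl fun k _ => ?_
          simp only [map_sub, map_mul]
          ring
      _ = _ := by
          rw [Finset.sum_add_distrib, Finset.sum_sub_distrib, Finset.sum_sub_distrib,
            ← Finset.mul_sum, ← Finset.mul_sum, ← Finset.sum_mul, hu, hu', hv]
          ring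
  simp_rw [Complex.conj_mul'] at h
  exact_mod_cast h

/-- The spectral gap of the antiholomorphic tangential derivative on functions of charge `-1`. -/
theorem spectral_gap (hd : 2 ≤ d) {M : ℕ} {P : CPoly d}
    (hP : P.IsHomogeneous (2 * M + 1))
    (hbar : P.IsWeightedHomogeneous (Sum.elim (fun _ => 0) (fun _ => 1)) (M + 1))
    (hhol : P.IsWeightedHomogeneous (Sum.elim (fun _ => 1) (fun _ => 0)) M) :
    ((d : ℝ) - 1) * ∫ ψ, ‖cEval ψ.1 P‖ ^ 2 ∂sphereMeasure d ≤
      ∫ ψ, ∑ k, ‖cEval ψ.1 (pderiv (Sum.inr k) P) - ψ.1 k * ((M + 1) * cEval ψ.1 P)‖ ^ 2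
        ∂sphereMeasure d := by
  have hN : ∀ ψ : PureState d, ‖ψ.1‖ = 1 := fun ψ => by simp
  have eulerBar : ∀ ψ : PureState d, ∑ k, conj (ψ.1 k) * cEval ψ.1 (pderiv (Sum.inr k) P) =
      (M + 1) * cEval ψ.1 P := fun ψ => by
    have := congrArg (cEval ψ.1) hbar.sum_weight_X_mul_pderiv
    simpa [Fintype.sum_sum_type, map_sum] using this
  have eulerHol : ∀ ψ : PureState d, ∑ k, ψ.1 k * cEval ψ.1 (pderiv (Sum.inl k) P) =
      M * cEval ψ.1 P := fun ψ => by
    have := congrArg (cEval ψ.1) hhol.sum_weight_X_mul_pderiv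
    simpa [Fintype.sum_sum_type, map_sum] using this
  set μ := sphereMeasure d
  set I := ∫ ψ, ‖cEval ψ.1 P‖ ^ 2 ∂μ with hI
  set A := ∫ ψ, ∑ k, ‖cEval ψ.1 (pderiv (Sum.inr k) P)‖ ^ 2 ∂μ with hA
  set B := ∫ ψ, ∑ k, ‖cEval ψ.1 (pderiv (Sum.inl k) P)‖ ^ 2 ∂μ with hB
  -- The mixed second-order term is the same whether one starts from antiholomorphic or holomorphic
  -- derivatives. It cancels between the two integrations by parts, leaving a relation between `A`,
  -- `B` and `I` only.
  set L := ∫ ψ, ∑ k, cEval ψ.1 (conjPoly P * pderiv (Sum.inl k) (pderiv (Sum.inr k) P)) ∂μ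
    with hL
  have cI : (I : ℂ) = ∫ ψ, conj (cEval ψ.1 P) * cEval ψ.1 P ∂μ := by
    rw [hI, ← integral_complex_ofReal]
    simp_rw [Complex.conj_mul']
    push_cast
    rfl
  have intP : ∀ Q : CPoly d, Integrable (fun ψ : PureState d => cEval ψ.1 Q) μ :=
    integrable_cEval_sphere
  have hAL : (A : ℂ) + L = (2 * M + d) * ((M + 1) * I) := by
    have h1 : (A : ℂ) + L = ∑ k, ∫ ψ, cEval ψ.1
        (pderiv (Sum.inl k) (conjPoly P * pderiv (Sum.inr k) P)) ∂μ := by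
      rw [hA, hL, ← integral_complex_ofReal, ← integral_finsetSum _ fun k _ => intP _,
        ← integral_add]
      · refine integral_congr_ae (Filter.Eventually.of_forall fun ψ => ?_)
        simp only
        rw [Complex.ofReal_sum, ← Finset.sum_add_distrib]
        refine Finset.sum_congr rfl fun k _ => ?_
        simp only [pderiv_mul, pderiv_inl_conjPoly, map_add, map_mul, cEval_conjPoly,
          Complex.conj_mul', Complex.ofReal_pow]
      · refine integrable_sphere_of_continuous (Complex.continuous_ofReal.comp ?_)
        exact continuous_finsetSum _ fun k _ => (continuous_cEval_sphere _).norm.pow 2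
      · exact integrable_finsetSum _ fun k _ => intP _
    rw [h1, cI, ← integral_const_mul, ← integral_const_mul]
    -- The product `conjPoly P * pderiv _ P` has degree `(2M + 1) + 2M = 2(2M) + 1`, so integration
    -- by parts contributes the factor `2M + d`; Euler's identity then contributes `M + 1`.
    rw [Finset.sum_congr rfl fun k _ => integral_sphere_pderiv_inl hd (n := 2 * M) (by
      convert (isHomogeneous_conjPoly hP).mul (hP.pderiv (i := Sum.inr k)) using 1
      omega), ← Finset.mul_sum, ← integral_finsetSum _ fun k _ => intP _,
      ← integral_const_mul]
    refine integral_congr_ae (Filter.Eventually.of_forall fun ψ => ?_)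
    have h2 : ∑ k, cEval ψ.1 (X (Sum.inr k) * (conjPoly P * pderiv (Sum.inr k) P)) =
        conj (cEval ψ.1 P) * ((M + 1) * cEval ψ.1 P) := by
      rw [← eulerBar, Finset.mul_sum]
      refine Finset.sum_congr rfl fun k _ => ?_
      rw [map_mul, map_mul, cEval_X_inr, cEval_conjPoly]
      ring
    simp only
    rw [h2]
    push_cast
    ring
  have hBL : (B : ℂ) + L = (2 * M + d) * (M * I) := by
    have h1 : (B : ℂ) + L = ∑ k, ∫ ψ, cEval ψ.1
        (pderiv (Sum.inr k) (conjPoly P * pderiv (Sum.inl k) P)) ∂μ := by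
      rw [hB, hL, ← integral_complex_ofReal, ← integral_finsetSum _ fun k _ => intP _,
        ← integral_add]
      · refine integral_congr_ae (Filter.Eventually.of_forall fun ψ => ?_)
        simp only
        rw [Complex.ofReal_sum, ← Finset.sum_add_distrib]
        refine Finset.sum_congr rfl fun k _ => ?_
        simp only [pderiv_mul, pderiv_inr_conjPoly, map_add, map_mul, cEval_conjPoly,
          Complex.conj_mul', Complex.ofReal_pow, pderiv_comm (Sum.inr k) (Sum.inl k)]
      · refine integrable_sphere_of_continuous (Complex.continuous_ofReal.comp ?_)
        exact continuous_finsetSum _ fun k _ => (continuous_cEval_sphere _).norm.pow 2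
      · exact integrable_finsetSum _ fun k _ => intP _
    rw [h1, cI, ← integral_const_mul, ← integral_const_mul]
    rw [Finset.sum_congr rfl fun k _ => integral_sphere_pderiv_inr hd (n := 2 * M) (by
      convert (isHomogeneous_conjPoly hP).mul (hP.pderiv (i := Sum.inl k)) using 1
      omega), ← Finset.mul_sum, ← integral_finsetSum _ fun k _ => intP _,
      ← integral_const_mul]
    refine integral_congr_ae (Filter.Eventually.of_forall fun ψ => ?_)
    have h2 : ∑ k, cEval ψ.1 (X (Sum.inl k) * (conjPoly P * pderiv (Sum.inl k) P)) =
        conj (cEval ψ.1 P) * (M * cEval ψ.1 P) := by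
      rw [← eulerHol, Finset.mul_sum]
      refine Finset.sum_congr rfl fun k _ => ?_
      rw [map_mul, map_mul, cEval_X_inl, cEval_conjPoly]
      ring
    simp only
    rw [h2]
    push_cast
    ring
  have hAB : A - B = (2 * M + d) * I := by
    have : (A : ℂ) - B = (2 * M + d) * I := by linear_combination hAL - hBL
    exact_mod_cast this
  have cont : ∀ Q : CPoly d, Continuous fun ψ : PureState d => ‖cEval ψ.1 Q‖ ^ 2 := fun Q =>
    (continuous_cEval_sphere Q).norm.pow 2
  have intI : Integrable (fun ψ : PureState d => ‖cEval ψ.1 P‖ ^ 2) μ :=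
    integrable_sphere_of_continuous (cont P)
  -- The holomorphic gradient is at least as long as its radial part, which Euler's identity
  -- computes as `M P`.
  have hB' : (M : ℝ) ^ 2 * I ≤ B := by
    rw [hI, hB, ← integral_const_mul]
    refine integral_mono (intI.const_mul _) (integrable_sphere_of_continuous
      (continuous_finsetSum _ fun k _ => cont _)) fun ψ => ?_
    have h := sum_norm_sq_sub (u := fun k => cEval ψ.1 (pderiv (Sum.inl k) P))
      (v := fun k => conj (ψ.1 k)) (c := M * cEval ψ.1 P)
      (by simpa [mul_comm] using sum_conj_mul_self (hN ψ)) (by simpa using eulerHol ψ)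
    have h0 := Finset.sum_nonneg fun k (_ : k ∈ Finset.univ) => sq_nonneg
      ‖cEval ψ.1 (pderiv (Sum.inl k) P) - conj (ψ.1 k) * (M * cEval ψ.1 P)‖
    rw [h, norm_mul, mul_pow, Complex.norm_natCast] at h0
    simpa using h0
  have hA' : ∫ ψ, ∑ k, ‖cEval ψ.1 (pderiv (Sum.inr k) P) - ψ.1 k * ((M + 1) * cEval ψ.1 P)‖ ^ 2
      ∂μ = A - ((M : ℝ) + 1) ^ 2 * I := by
    rw [hI, hA, ← integral_const_mul, ← integral_sub (integrable_sphere_of_continuous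
      (continuous_finsetSum _ fun k _ => cont _)) (intI.const_mul _)]
    refine integral_congr_ae (Filter.Eventually.of_forall fun ψ => ?_)
    have h := sum_norm_sq_sub (u := fun k => cEval ψ.1 (pderiv (Sum.inr k) P))
      (v := fun k => ψ.1 k) (c := (M + 1) * cEval ψ.1 P) (sum_conj_mul_self (hN ψ)) (eulerBar ψ)
    have hM : ‖(M + 1 : ℂ)‖ = (M : ℝ) + 1 := by
      have := Complex.norm_natCast (M + 1)
      push_cast at this
      exact this
    rw [norm_mul, mul_pow, hM] at h
    exact h
  rw [hA']
  -- The gap is the arithmetic `(2M + d) + M² - (M + 1)² = d - 1`.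
  nlinarith

end SpectralGap

/-! ### Kraus decompositions and projections onto error patterns -/

section Kraus

variable {d : ℕ}

theorem matrix_eq_sum_single {m : Type*} [Fintype m] [DecidableEq m] (X : Matrix m m ℂ) :
    X = ∑ i, ∑ j, X i j • Matrix.single i j (1 : ℂ) := by
  simp only [Matrix.smul_single, smul_eq_mul, mul_one]
  exact Matrix.matrix_eq_sum_single X

/-- A channel has a Kraus decomposition. -/
theorem IsChannel.exists_kraus {m n : Type*} [Fintype m] [Fintype n] [DecidableEq m]
    {E : Matrix m m ℂ →ₗ[ℂ] Matrix n n ℂ} (hE : IsChannel E) :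
    ∃ (s : ℕ) (K : Fin s → Matrix n m ℂ), ∀ X, E X = ∑ r, K r * X * (K r)ᴴ := by
  let e := Fintype.equivFin m
  -- `Ω` is the unnormalised maximally entangled vector. The ampliation applied to its projector is
  -- the Choi matrix of `E`, and writing that positive matrix as a sum of rank-one terms yields the
  -- Kraus operators.
  let Ω : Fin (Fintype.card m) × m → ℂ := fun p => if p.1 = e p.2 then 1 else 0
  have hpos := hE.completelyPositive (Fintype.card m) _ (Matrix.posSemidef_vecMulVec_self_star Ω)
  obtain ⟨s, v, hv⟩ := Matrix.posSemidef_iff_eq_sum_vecMulVec.mp hpos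
  refine ⟨s, fun r => Matrix.of fun b a => v r (e a, b), fun X => ?_⟩
  have hsingle : ∀ i j, E (Matrix.single i j 1) =
      ∑ r, Matrix.of fun b c => v r (e i, b) * conj (v r (e j, c)) := fun i j => by
    ext b c
    have h := congrFun (congrFun hv (e i, b)) (e j, c)
    have h2 : (Matrix.of fun i' j' => Matrix.vecMulVec Ω (star Ω) (e i, i') (e j, j')) =
        Matrix.single i j (1 : ℂ) := by
      ext i' j'
      simp [Matrix.vecMulVec_apply, Matrix.single_apply, Ω, ← ite_and, and_comm]
    simp only [ampliation, Matrix.of_apply] at h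
    rw [h2] at h
    rw [h, Matrix.sum_apply, Matrix.sum_apply]
    simp [Matrix.vecMulVec_apply]
  conv_lhs => rw [matrix_eq_sum_single X]
  simp only [map_sum, map_smul, hsingle]
  ext b c
  simp only [Matrix.sum_apply, Matrix.smul_apply, Matrix.mul_apply, Matrix.conjTranspose_apply,
    Matrix.of_apply, smul_eq_mul, Finset.mul_sum, Finset.sum_mul, RCLike.star_def]
  rw [Finset.sum_congr rfl fun i _ => Finset.sum_comm, Finset.sum_comm]
  refine Finset.sum_congr rfl fun r _ => ?_
  rw [Finset.sum_comm]
  refine Finset.sum_congr rfl fun j _ => Finset.sum_congr rfl fun i _ => ?_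
  ring

/-- A Kraus family that resolves the identity defines a channel. -/
theorem isChannel_of_kraus {m n ι : Type*} [Fintype m] [Fintype n] [Fintype ι] [DecidableEq m]
    {E : Matrix m m ℂ →ₗ[ℂ] Matrix n n ℂ} (K : ι → Matrix n m ℂ)
    (hE : ∀ X, E X = ∑ r, K r * X * (K r)ᴴ) (hK : ∑ r, (K r)ᴴ * K r = 1) : IsChannel E where
  completelyPositive k X hX := by
    -- The ampliation has Kraus operators `1 ⊗ K r`, and conjugation preserves positivity.
    have h : ampliation E k X = ∑ r, (Matrix.kroneckerMap (· * ·) (1 : Matrix (Fin k) (Fin k) ℂ)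
        (K r)) * X * (Matrix.kroneckerMap (· * ·) (1 : Matrix (Fin k) (Fin k) ℂ) (K r))ᴴ := by
      ext ⟨p, b⟩ ⟨q, c⟩
      simp [ampliation, hE, Matrix.sum_apply, Matrix.mul_apply, Fintype.sum_prod_type,
        Matrix.one_apply, Matrix.conjTranspose_apply, apply_ite]
    rw [h]
    exact Matrix.posSemidef_sum _ fun r _ => hX.mul_mul_conjTranspose_same _
  tracePreserving X := by
    rw [hE, Matrix.trace_sum]
    simp_rw [fun r => Matrix.trace_mul_cycle (K r) X (K r)ᴴ]
    rw [← Matrix.trace_sum, ← Finset.sum_mul, hK, one_mul]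

/-- The vector `ψ^{⊗ n}`. -/
def tensorVec (n : ℕ) (ψ : EuclideanSpace ℂ (Fin d)) : Str d n → ℂ := fun a => ∏ j, ψ (a j)

theorem copies_eq_vecMulVec (n : ℕ) (ψ : EuclideanSpace ℂ (Fin d)) :
    copies n ψ = Matrix.vecMulVec (tensorVec n ψ) (star (tensorVec n ψ)) := by
  ext a b
  simp [copies, tensorVec, Matrix.vecMulVec_apply, Finset.prod_mul_distrib]

theorem trace_mul_kraus_vecMulVec {m n ι : Type*} [Fintype m] [Fintype n] [Fintype ι]
    (T : Matrix n n ℂ) (K : ι → Matrix n m ℂ) (v : m → ℂ) :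
    (T * ∑ r, K r * Matrix.vecMulVec v (star v) * (K r)ᴴ).trace =
      ∑ r, star (K r *ᵥ v) ⬝ᵥ (T *ᵥ (K r *ᵥ v)) := by
  rw [Finset.mul_sum, Matrix.trace_sum]
  refine Finset.sum_congr rfl fun r _ => ?_
  rw [Matrix.mul_vecMulVec, Matrix.vecMulVec_mul, ← Matrix.star_mulVec, Matrix.mul_vecMulVec,
    Matrix.trace_vecMulVec, dotProduct_comm]

/-- The tensor product of one-site operators. -/
def siteOp {n : ℕ} (T : Fin n → Matrix (Fin d) (Fin d) ℂ) : Op d n :=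
  Matrix.of fun a b => ∏ j, T j (a j) (b j)

/-- The one-site projection `|ψ⟩⟨ψ|`. -/
def ketbra (ψ : EuclideanSpace ℂ (Fin d)) : Matrix (Fin d) (Fin d) ℂ :=
  Matrix.of fun k l => ψ k * conj (ψ l)

theorem siteOp_mul {n : ℕ} (S T : Fin n → Matrix (Fin d) (Fin d) ℂ) :
    siteOp S * siteOp T = siteOp fun j => S j * T j := by
  ext a b
  simp only [siteOp, Matrix.mul_apply, Matrix.of_apply, ← Finset.prod_mul_distrib]
  exact (Fintype.prod_sum fun j k => S j (a j) k * T j k (b j)).symm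

theorem siteOp_conjTranspose {n : ℕ} (T : Fin n → Matrix (Fin d) (Fin d) ℂ) :
    (siteOp T)ᴴ = siteOp fun j => (T j)ᴴ := by
  ext a b
  simp [siteOp, Matrix.conjTranspose_apply]

theorem posSemidef_siteOp {n : ℕ} {T : Fin n → Matrix (Fin d) (Fin d) ℂ}
    (hT : ∀ j, (T j)ᴴ = T j) (hT2 : ∀ j, T j * T j = T j) : (siteOp T).PosSemidef := by
  have h : siteOp T = (siteOp T)ᴴ * siteOp T := by
    rw [siteOp_conjTranspose, siteOp_mul]
    simp only [hT, hT2]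
  rw [h]
  exact Matrix.posSemidef_conjTranspose_mul_self _

theorem ketbra_conjTranspose (ψ : EuclideanSpace ℂ (Fin d)) : (ketbra ψ)ᴴ = ketbra ψ := by
  ext k l
  simp [ketbra, mul_comm]

theorem ketbra_mul_self {ψ : EuclideanSpace ℂ (Fin d)} (hψ : ‖ψ‖ = 1) :
    ketbra ψ * ketbra ψ = ketbra ψ := by
  ext k l
  simp only [ketbra, Matrix.mul_apply, Matrix.of_apply]
  calc _ = ψ k * conj (ψ l) * ∑ j, conj (ψ j) * ψ j := by
        rw [Finset.mul_sum]
        exact Finset.sum_congr rfl fun j _ => by ring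
    _ = _ := by rw [sum_conj_mul_self hψ, mul_one]

theorem siteProj_eq_siteOp {n : ℕ} (y : Finset (Fin n)) (ψ : EuclideanSpace ℂ (Fin d)) :
    siteProj y ψ = siteOp fun j => if j ∈ y then ketbra ψ else 1 := by
  ext a b
  simp only [siteProj, siteOp, Matrix.of_apply]
  refine Finset.prod_congr rfl fun j _ => ?_
  by_cases h : j ∈ y
  · rw [if_pos h, if_pos h]
    rfl
  · rw [if_neg h, if_neg h, Matrix.one_apply]

/-- The projection onto "the clones at the sites of `S`, and no others, are wrong". -/
def errProj {n : ℕ} (S : Finset (Fin n)) (ψ : EuclideanSpace ℂ (Fin d)) : Op d n :=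
  siteOp fun j => if j ∈ S then 1 - ketbra ψ else ketbra ψ

theorem posSemidef_errProj {n : ℕ} (S : Finset (Fin n)) {ψ : EuclideanSpace ℂ (Fin d)}
    (hψ : ‖ψ‖ = 1) : (errProj S ψ).PosSemidef := by
  refine posSemidef_siteOp (fun j => ?_) fun j => ?_
  · split_ifs <;> simp [ketbra_conjTranspose]
  · split_ifs
    · simp [sub_mul, mul_sub, ketbra_mul_self hψ]
    · exact ketbra_mul_self hψ

/-- Expand `1 = (1 - |ψ⟩⟨ψ|) + |ψ⟩⟨ψ|` at each site outside `y`. At sites of `y` the first summand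
is taken to be `0`, so only patterns `S` disjoint from `y` survive. -/
theorem siteProj_eq_sum_errProj {n : ℕ} (y : Finset (Fin n)) (ψ : EuclideanSpace ℂ (Fin d)) :
    siteProj y ψ = ∑ S with Disjoint S y, errProj S ψ := by
  ext a b
  rw [siteProj_eq_siteOp, Matrix.sum_apply]
  simp only [siteOp, errProj, Matrix.of_apply]
  have h : ∀ j, (if j ∈ y then ketbra ψ else 1) (a j) (b j) =
      (if j ∈ y then 0 else (1 - ketbra ψ) (a j) (b j)) + ketbra ψ (a j) (b j) := fun j => by
    split_ifs <;> simp
  rw [Finset.prod_congr rfl fun j _ => h j, Finset.prod_add, Finset.powerset_univ,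
    Finset.sum_filter]
  refine Finset.sum_congr rfl fun S _ => ?_
  split_ifs with hS
  · rw [← Finset.prod_mul_prod_compl S]
    congr 1
    · refine Finset.prod_congr rfl fun j hj => ?_
      rw [if_neg (Finset.disjoint_left.mp hS hj), if_pos hj]
    · rw [← Finset.compl_eq_univ_sdiff]
      refine Finset.prod_congr rfl fun j hj => ?_
      rw [if_neg (Finset.mem_compl.mp hj)]
  · obtain ⟨j, hj, hjy⟩ := Finset.not_disjoint_iff.mp hS
    rw [Finset.prod_eq_zero hj (by simp [hjy]), zero_mul]

end Kraus

/-! ### The probability distribution of error patterns -/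

section ErrorDistribution

variable {d : ℕ}

theorem continuous_copies (M : ℕ) :
    Continuous fun ψ : PureState d => copies M ψ.1 := by
  refine continuous_matrix fun a b => ?_
  simp only [copies, Matrix.of_apply]
  fun_prop

theorem continuous_errProj {N : ℕ} (S : Finset (Fin N)) :
    Continuous fun ψ : PureState d => errProj S ψ.1 := by
  have h : Continuous fun ψ : PureState d => ketbra ψ.1 := by
    refine continuous_matrix fun k l => ?_
    simp only [ketbra, Matrix.of_apply]
    fun_prop
  refine continuous_matrix fun a b => ?_
  simp only [errProj, siteOp, Matrix.of_apply]
  refine continuous_finsetProd _ fun j _ => ?_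
  split_ifs
  · exact (continuous_const.sub h).matrix_elem _ _
  · exact h.matrix_elem _ _

theorem continuous_trace_errProj {M N : ℕ} (E : Op d M →ₗ[ℂ] Op d N) (S : Finset (Fin N)) :
    Continuous fun ψ : PureState d => (errProj S ψ.1 * E (copies M ψ.1)).trace.re :=
  Complex.continuous_re.comp (((continuous_errProj S).matrix_mul
    ((LinearMap.continuous_of_finiteDimensional E).comp (continuous_copies M))).matrix_trace)

/-- The average probability that exactly the clones at the sites of `S` are wrong. -/
noncomputable def errProb {M N : ℕ} (E : Op d M →ₗ[ℂ] Op d N) (S : Finset (Fin N)) : ℝ :=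
  ⨍ ψ : PureState d, (errProj S ψ.1 * E (copies M ψ.1)).trace.re ∂(sphereMeasure d)

theorem norm_pureState (ψ : PureState d) : ‖ψ.1‖ = 1 := by simp

theorem fidelity_eq_sum_errProb {M N : ℕ} (E : Op d M →ₗ[ℂ] Op d N) (y : Finset (Fin N)) :
    fidelity E y = ∑ S with Disjoint S y, errProb E S := by
  simp only [fidelity, errProb, average_eq, ← Finset.smul_sum]
  rw [← integral_finsetSum _ fun S _ =>
    integrable_sphere_of_continuous (continuous_trace_errProj E S)]
  simp only [siteProj_eq_sum_errProj, Finset.sum_mul, Matrix.trace_sum, Complex.re_sum]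

theorem errProb_nonneg {M N : ℕ} {E : Op d M →ₗ[ℂ] Op d N} (hE : IsChannel E)
    (S : Finset (Fin N)) : 0 ≤ errProb E S := by
  obtain ⟨s, K, hK⟩ := hE.exists_kraus
  rw [errProb, average_eq]
  refine smul_nonneg (by positivity) (integral_nonneg fun ψ => ?_)
  simp only [Pi.zero_apply]
  rw [hK, copies_eq_vecMulVec, trace_mul_kraus_vecMulVec, Complex.re_sum]
  refine Finset.sum_nonneg fun r _ => ?_
  exact (Complex.nonneg_iff.mp
    ((posSemidef_errProj S (norm_pureState ψ)).dotProduct_mulVec_nonneg _)).1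

theorem trace_copies (M : ℕ) {ψ : EuclideanSpace ℂ (Fin d)} (hψ : ‖ψ‖ = 1) :
    (copies M ψ).trace = 1 := by
  simp only [copies, Matrix.trace, Matrix.diag, Matrix.of_apply]
  rw [← Fintype.prod_sum fun (_ : Fin M) k => ψ k * conj (ψ k)]
  have h := sum_conj_mul_self hψ
  simp only [mul_comm (conj _)] at h
  simp [h]

theorem fidelity_empty (hd : 2 ≤ d) {M N : ℕ} {E : Op d M →ₗ[ℂ] Op d N} (hE : IsChannel E) :
    fidelity E ∅ = 1 := by
  have : NeZero (sphereMeasure d) := ⟨sphereMeasure_ne_zero hd⟩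
  have h : ∀ ψ : PureState d, (siteProj ∅ ψ.1 * E (copies M ψ.1)).trace.re = 1 := fun ψ => by
    have h1 : (siteProj ∅ ψ.1 : Op d N) = 1 := by
      ext a b
      simp [siteProj, Finset.prod_ite_zero, Matrix.one_apply, funext_iff]
    rw [h1, one_mul, hE.tracePreserving, trace_copies M (norm_pureState ψ), Complex.one_re]
  simp only [fidelity, h]
  exact average_const _ _

theorem sum_errProb (hd : 2 ≤ d) {M N : ℕ} {E : Op d M →ₗ[ℂ] Op d N} (hE : IsChannel E) :
    ∑ S, errProb E S = 1 := by
  rw [← fidelity_empty hd hE, fidelity_eq_sum_errProb]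
  simp

theorem one_sub_fidelity (hd : 2 ≤ d) {M N : ℕ} {E : Op d M →ₗ[ℂ] Op d N} (hE : IsChannel E)
    (y : Finset (Fin N)) : 1 - fidelity E y = ∑ S with ¬ Disjoint S y, errProb E S := by
  rw [← sum_errProb hd hE, fidelity_eq_sum_errProb,
    ← Finset.sum_filter_add_sum_filter_not Finset.univ (fun S => Disjoint S y)]
  ring

theorem fidelity_le_one (hd : 2 ≤ d) {M N : ℕ} {E : Op d M →ₗ[ℂ] Op d N} (hE : IsChannel E)
    (y : Finset (Fin N)) : fidelity E y ≤ 1 := by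
  have := one_sub_fidelity hd hE y
  have h2 : 0 ≤ ∑ S with ¬ Disjoint S y, errProb E S :=
    Finset.sum_nonneg fun S _ => errProb_nonneg hE S
  linarith

/-- The union bound. -/
theorem one_sub_fidelity_le_sum (hd : 2 ≤ d) {M N : ℕ} {E : Op d M →ₗ[ℂ] Op d N}
    (hE : IsChannel E) (y : Finset (Fin N)) :
    1 - fidelity E y ≤ ∑ n ∈ y, (1 - fidelity E {n}) := by
  simp only [one_sub_fidelity hd hE, Finset.sum_filter]
  rw [Finset.sum_comm]
  refine Finset.sum_le_sum fun S _ => ?_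
  have hterm : ∀ n ∈ y, 0 ≤ if ¬ Disjoint S {n} then errProb E S else 0 := fun n _ => by
    by_cases h : Disjoint S {n}
    · rw [if_neg (not_not.mpr h)]
    · rw [if_pos h]
      exact errProb_nonneg hE S
  by_cases h : Disjoint S y
  · rw [if_neg (not_not.mpr h)]
    exact Finset.sum_nonneg hterm
  · obtain ⟨n, hnS, hny⟩ := Finset.not_disjoint_iff.mp h
    have h1 := Finset.single_le_sum hterm hny
    rw [if_pos (by simpa using hnS)] at h1
    rwa [if_pos h]

/-- The average probability that the first wrong clone is the one at site `n`. -/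
noncomputable def firstErrProb {M N : ℕ} (E : Op d M →ₗ[ℂ] Op d N) (n : Fin N) : ℝ :=
  ∑ S with n ∈ S ∧ ∀ m ∈ S, n ≤ m, errProb E S

theorem errProb_singleton_le_firstErrProb {M N : ℕ} {E : Op d M →ₗ[ℂ] Op d N}
    (hE : IsChannel E) (n : Fin N) : errProb E {n} ≤ firstErrProb E n :=
  Finset.single_le_sum (f := fun S => errProb E S) (fun S _ => errProb_nonneg hE S) (by simp)

theorem firstErrProb_nonneg {M N : ℕ} {E : Op d M →ₗ[ℂ] Op d N}
    (hE : IsChannel E) (n : Fin N) : 0 ≤ firstErrProb E n :=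
  Finset.sum_nonneg fun S _ => errProb_nonneg hE S

/-- A pattern `S` has at most one first site. It is therefore counted at most once on the left, and
only if it meets `y`. -/
theorem sum_firstErrProb_le (hd : 2 ≤ d) {M N : ℕ} {E : Op d M →ₗ[ℂ] Op d N}
    (hE : IsChannel E) (y : Finset (Fin N)) :
    ∑ n ∈ y, firstErrProb E n ≤ 1 - fidelity E y := by
  simp only [one_sub_fidelity hd hE, firstErrProb, Finset.sum_filter]
  rw [Finset.sum_comm]
  refine Finset.sum_le_sum fun S _ => ?_
  rw [← Finset.sum_filter, Finset.sum_const, nsmul_eq_mul]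
  have hcard : ({n ∈ y | n ∈ S ∧ ∀ m ∈ S, n ≤ m} : Finset (Fin N)).card ≤ 1 :=
    Finset.card_le_one.mpr fun a ha b hb => by
      simp only [Finset.mem_filter] at ha hb
      exact le_antisymm (ha.2.2 _ hb.2.1) (hb.2.2 _ ha.2.1)
  by_cases h : Disjoint S y
  · have : ({n ∈ y | n ∈ S ∧ ∀ m ∈ S, n ≤ m} : Finset (Fin N)) = ∅ :=
      Finset.filter_eq_empty_iff.mpr fun n hn hS => Finset.disjoint_left.mp h hS.1 hn
    simp [this, h]
  · have : (({n ∈ y | n ∈ S ∧ ∀ m ∈ S, n ≤ m} : Finset (Fin N)).card : ℝ) ≤ 1 := by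
      exact_mod_cast hcard
    rw [if_pos h]
    exact mul_le_of_le_one_left (errProb_nonneg hE S) this

/-- Every non-empty pattern is counted exactly once, at its minimum. -/
theorem sum_firstErrProb (hd : 2 ≤ d) {M N : ℕ} {E : Op d M →ₗ[ℂ] Op d N} (hE : IsChannel E) :
    ∑ n, firstErrProb E n = 1 - errProb E ∅ := by
  rw [← sum_errProb hd hE, ← Finset.sum_erase_eq_sub (Finset.mem_univ ∅)]
  simp only [firstErrProb, Finset.sum_filter]
  rw [Finset.sum_comm, ← Finset.sum_erase Finset.univ (a := ∅) (by simp)]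
  refine Finset.sum_congr rfl fun S hS => ?_
  have hne : S.Nonempty := Finset.nonempty_iff_ne_empty.mpr (Finset.ne_of_mem_erase hS)
  rw [Finset.sum_eq_single (S.min' hne)]
  · rw [if_pos ⟨S.min'_mem hne, fun m hm => S.min'_le m hm⟩]
  · intro n _ hn
    rw [if_neg]
    rintro ⟨h1, h2⟩
    exact hn (le_antisymm (h2 _ (S.min'_mem hne)) (S.min'_le n h1))
  · simp

end ErrorDistribution

/-! ### The bound on the fidelities of an arbitrary channel -/

section TradeOffBound

open MvPolynomial

variable {d : ℕ}

theorem pderiv_prod {σ ι : Type*} [DecidableEq ι] (i : σ) (s : Finset ι)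
    (g : ι → MvPolynomial σ ℂ) :
    pderiv i (∏ j ∈ s, g j) = ∑ j ∈ s, (∏ l ∈ s.erase j, g l) * pderiv i (g j) := by
  induction s using Finset.induction_on with
  | empty => simp
  | insert a s ha ih =>
    rw [Finset.prod_insert ha, pderiv_mul, ih, Finset.sum_insert ha, Finset.erase_insert ha,
      Finset.mul_sum, mul_comm (pderiv i (g a))]
    congr 1
    refine Finset.sum_congr rfl fun j hj => ?_
    have hne : a ≠ j := fun h => ha (h ▸ hj)
    rw [Finset.erase_insert_of_ne hne, Finset.prod_insert (fun h => ha (Finset.mem_of_mem_erase h)),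
      mul_assoc]

/-- The polynomial `⟨ψ^{⊗ N}, K ψ^{⊗ M}⟩`. -/
noncomputable def overlapPoly {M N : ℕ} (K : Matrix (Str d N) (Str d M) ℂ) : CPoly d :=
  ∑ a, ∑ b, C (K a b) * ((∏ n, X (Sum.inr (a n))) * ∏ m, X (Sum.inl (b m)))

/-- Leaving the weights free gives the holomorphic degree at `(1, 0)`, the antiholomorphic degree at
`(0, 1)` and the total degree at `(1, 1)`, all of which the spectral gap needs. -/
theorem overlapPoly_isWeightedHomogeneous {M N : ℕ} (K : Matrix (Str d N) (Str d M) ℂ)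
    (p q : ℕ) : (overlapPoly K).IsWeightedHomogeneous
      (Sum.elim (fun _ => p) (fun _ => q)) (N * q + M * p) := by
  refine IsWeightedHomogeneous.sum _ _ _ fun a _ => IsWeightedHomogeneous.sum _ _ _ fun b _ =>
    IsWeightedHomogeneous.C_mul (IsWeightedHomogeneous.mul ?_ ?_) _
  · have h := IsWeightedHomogeneous.prod (R := ℂ) (Finset.univ : Finset (Fin N))
      (fun n => X (Sum.inr (a n))) (fun _ => q)
      (w := Sum.elim (fun _ : Fin d => p) (fun _ : Fin d => q))
      fun n _ => isWeightedHomogeneous_X ℂ _ _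
    simpa using h
  · have h := IsWeightedHomogeneous.prod (R := ℂ) (Finset.univ : Finset (Fin M))
      (fun n => X (Sum.inl (b n))) (fun _ => p)
      (w := Sum.elim (fun _ : Fin d => p) (fun _ : Fin d => q))
      fun n _ => isWeightedHomogeneous_X ℂ _ _
    simpa using h

theorem overlapPoly_isHomogeneous {M N : ℕ} (K : Matrix (Str d N) (Str d M) ℂ) :
    (overlapPoly K).IsHomogeneous (N + M) := by
  have h := overlapPoly_isWeightedHomogeneous K 1 1
  have hw : (Sum.elim (fun _ => 1) (fun _ => 1) : Fin d ⊕ Fin d → ℕ) = 1 := by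
    ext i
    cases i <;> rfl
  rw [hw, mul_one, mul_one] at h
  exact h

/-- The overlap of `v` with `ψ^{⊗ N}`. -/
noncomputable def overlap {N : ℕ} (v : Str d N → ℂ) (ψ : EuclideanSpace ℂ (Fin d)) : ℂ :=
  ∑ a, (∏ j, conj (ψ (a j))) * v a

/-- The partial overlap of `v` with `ψ` on all sites but `n`. -/
noncomputable def partialOverlap {N : ℕ} (v : Str d N → ℂ) (n : Fin N)
    (ψ : EuclideanSpace ℂ (Fin d)) (k : Fin d) : ℂ :=
  ∑ a, if a n = k then (∏ j ∈ Finset.univ.erase n, conj (ψ (a j))) * v a else 0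

theorem sum_conj_mul_partialOverlap {N : ℕ} (v : Str d N → ℂ) (n : Fin N)
    (ψ : EuclideanSpace ℂ (Fin d)) :
    ∑ k, conj (ψ k) * partialOverlap v n ψ k = overlap v ψ := by
  simp only [partialOverlap, overlap, Finset.mul_sum]
  rw [Finset.sum_comm]
  refine Finset.sum_congr rfl fun a _ => ?_
  rw [← Finset.mul_prod_erase _ _ (Finset.mem_univ n)]
  simp [mul_assoc]

theorem cEval_overlapPoly {M N : ℕ} (K : Matrix (Str d N) (Str d M) ℂ)
    (ψ : EuclideanSpace ℂ (Fin d)) :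
    cEval ψ (overlapPoly K) = overlap (K *ᵥ tensorVec M ψ) ψ := by
  simp only [overlapPoly, overlap, map_sum, map_mul, map_prod, cEval_C, cEval_X_inl, cEval_X_inr,
    Matrix.mulVec, dotProduct, Finset.mul_sum, tensorVec]
  refine Finset.sum_congr rfl fun a _ => Finset.sum_congr rfl fun b _ => ?_
  ring

/-- By the Leibniz rule, differentiating in `conj (ψ k)` removes the bra at one output site at a
time and fixes that site to `k`. The inputs contain no conjugate variables. -/
theorem cEval_pderiv_overlapPoly {M N : ℕ} (K : Matrix (Str d N) (Str d M) ℂ)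
    (ψ : EuclideanSpace ℂ (Fin d)) (k : Fin d) :
    cEval ψ (pderiv (Sum.inr k) (overlapPoly K)) =
      ∑ n, partialOverlap (K *ᵥ tensorVec M ψ) n ψ k := by
  have h1 : ∀ a : Str d N, cEval ψ (pderiv (Sum.inr k) (∏ n, X (Sum.inr (a n)))) =
      ∑ n, if a n = k then ∏ j ∈ Finset.univ.erase n, conj (ψ (a j)) else 0 := fun a => by
    rw [pderiv_prod, map_sum]
    refine Finset.sum_congr rfl fun n _ => ?_
    by_cases h : a n = k
    · simp [h, map_prod]
    · have hne : (Sum.inr (a n) : Fin d ⊕ Fin d) ≠ Sum.inr k := fun h' => h (Sum.inr_injective h')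
      rw [pderiv_X_of_ne hne, if_neg h, mul_zero, map_zero]
  have h2 : ∀ b : Str d M, pderiv (Sum.inr k) (∏ m, X (Sum.inl (b m)) : CPoly d) = 0 := fun b => by
    rw [pderiv_prod]
    refine Finset.sum_eq_zero fun m _ => ?_
    rw [pderiv_X_of_ne (by simp), mul_zero]
  have h3 : ∀ a b, cEval ψ (pderiv (Sum.inr k)
      (C (K a b) * ((∏ n, X (Sum.inr (a n))) * ∏ m, X (Sum.inl (b m))))) =
      ∑ n, if a n = k then (∏ j ∈ Finset.univ.erase n, conj (ψ (a j))) *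
        (K a b * ∏ m, ψ (b m)) else 0 := fun a b => by
    rw [pderiv_C_mul, pderiv_mul, h2, mul_zero, add_zero, map_mul, map_mul, h1, cEval_C, map_prod,
      Finset.sum_mul, Finset.mul_sum]
    refine Finset.sum_congr rfl fun n _ => ?_
    split_ifs
    · simp only [cEval_X_inl]
      ring
    · simp
  simp only [overlapPoly, map_sum, h3, partialOverlap, Matrix.mulVec, dotProduct, tensorVec,
    Finset.mul_sum]
  rw [Finset.sum_congr rfl fun a _ => Finset.sum_comm, Finset.sum_comm]
  refine Finset.sum_congr rfl fun n _ => Finset.sum_congr rfl fun a _ => ?_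
  split_ifs
  · rfl
  · simp

/-- The part of the partial overlap orthogonal to `ψ`. -/
noncomputable def errOverlap {N : ℕ} (v : Str d N → ℂ) (n : Fin N)
    (ψ : EuclideanSpace ℂ (Fin d)) (k : Fin d) : ℂ :=
  partialOverlap v n ψ k - ψ k * overlap v ψ

theorem expect_errProj_empty {N : ℕ} (v : Str d N → ℂ) (ψ : EuclideanSpace ℂ (Fin d)) :
    star v ⬝ᵥ (errProj ∅ ψ *ᵥ v) = (‖overlap v ψ‖ ^ 2 : ℝ) := by
  rw [Complex.ofReal_pow, ← Complex.conj_mul']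
  simp only [dotProduct, Matrix.mulVec, errProj, siteOp, overlap, map_sum, Finset.mul_sum,
    Finset.sum_mul, map_mul, map_prod, Complex.conj_conj, Matrix.of_apply, ketbra,
    Finset.notMem_empty, if_false, Finset.prod_mul_distrib, Pi.star_apply, RCLike.star_def]
  rw [Finset.sum_comm]
  refine Finset.sum_congr rfl fun a _ => Finset.sum_congr rfl fun b _ => ?_
  ring

/-- Adding `errProj ∅` to `errProj {n}` puts the identity at site `n`, and the expectation of the
sum is the squared norm of the partial overlap. Pythagoras then removes the component along `ψ`,
which accounts for `errProj ∅`. -/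
theorem expect_errProj_singleton {N : ℕ} (v : Str d N → ℂ) (n : Fin N)
    {ψ : EuclideanSpace ℂ (Fin d)} (hψ : ‖ψ‖ = 1) :
    star v ⬝ᵥ (errProj {n} ψ *ᵥ v) = (∑ k, ‖errOverlap v n ψ k‖ ^ 2 : ℝ) := by
  have h := sum_norm_sq_sub (u := partialOverlap v n ψ) (v := fun k => ψ k)
    (sum_conj_mul_self hψ) (sum_conj_mul_partialOverlap v n ψ)
  simp only [errOverlap]
  rw [h, Complex.ofReal_sub, ← expect_errProj_empty, eq_sub_iff_add_eq, ← dotProduct_add,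
    ← Matrix.add_mulVec]
  have hadd : errProj {n} ψ + errProj ∅ ψ = Matrix.of fun a b : Str d N =>
      if a n = b n then ∏ j ∈ Finset.univ.erase n, ψ (a j) * conj (ψ (b j)) else 0 := by
    ext a b
    simp only [errProj, siteOp, Matrix.add_apply, Matrix.of_apply]
    rw [← Finset.mul_prod_erase _ _ (Finset.mem_univ n),
      ← Finset.mul_prod_erase _ _ (Finset.mem_univ n)]
    have h1 : ∀ j ∈ Finset.univ.erase n, (if j ∈ ({n} : Finset (Fin N)) then 1 - ketbra ψ
        else ketbra ψ) (a j) (b j) = ψ (a j) * conj (ψ (b j)) := fun j hj => by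
      rw [if_neg (by simpa using Finset.ne_of_mem_erase hj)]
      rfl
    have h2 : ∀ j ∈ Finset.univ.erase n, (if j ∈ (∅ : Finset (Fin N)) then 1 - ketbra ψ
        else ketbra ψ) (a j) (b j) = ψ (a j) * conj (ψ (b j)) := fun j hj => by
      rw [if_neg (by simp)]
      rfl
    rw [Finset.prod_congr rfl h1, Finset.prod_congr rfl h2, ← add_mul]
    simp [Matrix.one_apply]
  rw [hadd]
  push_cast
  simp_rw [← Complex.conj_mul', partialOverlap, map_sum, Finset.sum_mul_sum]
  rw [Finset.sum_comm]
  simp only [dotProduct, Matrix.mulVec, Finset.mul_sum, Matrix.of_apply, Pi.star_apply,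
    RCLike.star_def]
  refine Finset.sum_congr rfl fun a _ => ?_
  rw [Finset.sum_comm]
  refine Finset.sum_congr rfl fun b _ => ?_
  simp only [apply_ite conj, map_zero, ite_mul, zero_mul, Finset.sum_ite_eq, Finset.mem_univ,
    if_true, mul_ite, mul_zero]
  split_ifs
  · simp only [map_mul, map_prod, Complex.conj_conj, Finset.prod_mul_distrib]
    ring
  · rfl

/-- The triangle inequality in `L²`. -/
theorem integral_sum_norm_sq_sum_le {X ι : Type*} [MeasurableSpace X] (μ : Measure X)
    [Fintype ι] {N : ℕ} (w : Fin N → X → ι → ℂ)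
    (hint : ∀ n, Integrable (fun x => ∑ i, ‖w n x i‖ ^ 2) μ) :
    ∫ x, ∑ i, ‖∑ n, w n x i‖ ^ 2 ∂μ ≤ (∑ n, √(∫ x, ∑ i, ‖w n x i‖ ^ 2 ∂μ)) ^ 2 := by
  set q : Fin N → ℝ := fun n => ∫ x, ∑ i, ‖w n x i‖ ^ 2 ∂μ with hq
  have hq0 : ∀ n, 0 ≤ q n := fun n =>
    integral_nonneg fun x => Finset.sum_nonneg fun i _ => sq_nonneg _
  -- Weighted Cauchy–Schwarz with weights `√(q n)` is the optimal choice, but these may vanish. The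
  -- shift by `ε` permits division, and `ε → 0` at the end.
  have key : ∀ ε > 0, ∫ x, ∑ i, ‖∑ n, w n x i‖ ^ 2 ∂μ ≤ (∑ n, (√(q n) + ε)) * ∑ n, √(q n) := by
    intro ε hε
    have hs : ∀ n, 0 < √(q n) + ε := fun n => by positivity
    calc ∫ x, ∑ i, ‖∑ n, w n x i‖ ^ 2 ∂μ
        ≤ ∫ x, (∑ n, (√(q n) + ε)) * ∑ n, (√(q n) + ε)⁻¹ * ∑ i, ‖w n x i‖ ^ 2 ∂μ := by
          refine integral_mono_of_nonneg
            (Filter.Eventually.of_forall fun x => Finset.sum_nonneg fun i _ => sq_nonneg _)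
            ((integrable_finsetSum _ fun n _ => (hint n).const_mul _).const_mul _)
            (Filter.Eventually.of_forall fun x => ?_)
          have hswap : ∑ n, (√(q n) + ε)⁻¹ * ∑ i, ‖w n x i‖ ^ 2 =
              ∑ i, ∑ n, (√(q n) + ε)⁻¹ * ‖w n x i‖ ^ 2 := by
            simp only [Finset.mul_sum]
            exact Finset.sum_comm
          simp only
          rw [hswap, Finset.mul_sum]
          refine Finset.sum_le_sum fun i _ => ?_
          refine (pow_le_pow_left₀ (norm_nonneg _) (norm_sum_le _ _) 2).trans
            (Finset.sum_sq_le_sum_mul_sum_of_sq_le_mul _ (fun n _ => (hs n).le)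
              (fun n _ => mul_nonneg (inv_nonneg.mpr (hs n).le) (sq_nonneg _)) fun n _ => ?_)
          rw [mul_inv_cancel_left₀ (hs n).ne']
      _ = (∑ n, (√(q n) + ε)) * ∑ n, (√(q n) + ε)⁻¹ * q n := by
          rw [integral_const_mul, integral_finsetSum _ fun n _ => (hint n).const_mul _]
          simp_rw [integral_const_mul, hq]
      _ ≤ _ := by
          refine mul_le_mul_of_nonneg_left (Finset.sum_le_sum fun n _ => ?_)
            (Finset.sum_nonneg fun n _ => (hs n).le)
          rw [inv_mul_le_iff₀ (hs n)]
          nlinarith [Real.mul_self_sqrt (hq0 n), Real.sqrt_nonneg (q n)]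
  have hlim : Filter.Tendsto (fun ε : ℝ => (∑ n, (√(q n) + ε)) * ∑ n, √(q n))
      (nhdsWithin 0 (Set.Ioi 0)) (nhds ((∑ n, (√(q n) + 0)) * ∑ n, √(q n))) := by
    refine Filter.Tendsto.mono_left ?_ nhdsWithin_le_nhds
    exact Continuous.tendsto (f := fun ε : ℝ => (∑ n, (√(q n) + ε)) * ∑ n, √(q n))
      (by fun_prop) 0
  have := ge_of_tendsto hlim (Filter.eventually_of_mem self_mem_nhdsWithin fun ε hε => key ε hε)
  simp only [add_zero] at this
  rw [sq]
  exact this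

theorem trace_errProj_kraus {M N s : ℕ} {E : Op d M →ₗ[ℂ] Op d N}
    {K : Fin s → Matrix (Str d N) (Str d M) ℂ} (hK : ∀ X, E X = ∑ r, K r * X * (K r)ᴴ)
    (S : Finset (Fin N)) (ψ : EuclideanSpace ℂ (Fin d)) :
    (errProj S ψ * E (copies M ψ)).trace = ∑ r, star (K r *ᵥ tensorVec M ψ) ⬝ᵥ
      (errProj S ψ *ᵥ (K r *ᵥ tensorVec M ψ)) := by
  rw [hK, copies_eq_vecMulVec, trace_mul_kraus_vecMulVec]

/-- The probability of no error is controlled by the probabilities of a single error. -/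
theorem errProb_empty_le (hd : 2 ≤ d) {M : ℕ} {E : Op d M →ₗ[ℂ] Op d (M + 1)}
    (hE : IsChannel E) :
    ((d : ℝ) - 1) * errProb E ∅ ≤ (∑ n, √(errProb E {n})) ^ 2 := by
  obtain ⟨s, K, hK⟩ := hE.exists_kraus
  set v : Fin s → EuclideanSpace ℂ (Fin d) → Str d (M + 1) → ℂ :=
    fun r ψ => K r *ᵥ tensorVec M ψ with hv
  set w : Fin (M + 1) → PureState d → Fin s × Fin d → ℂ :=
    fun n ψ i => errOverlap (v i.1 ψ.1) n ψ.1 i.2 with hw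
  -- The link between gap and errors: each of the `M + 1` sites subtracts one copy of `ψ k` times
  -- the overlap, which together form the radial part of the gradient.
  have hsum : ∀ ψ : PureState d, ∀ r k, ∑ n, w n ψ (r, k) =
      cEval ψ.1 (pderiv (Sum.inr k) (overlapPoly (K r))) -
        ψ.1 k * ((M + 1) * cEval ψ.1 (overlapPoly (K r))) := fun ψ r k => by
    rw [cEval_pderiv_overlapPoly, cEval_overlapPoly]
    simp only [hw, hv, errOverlap, Finset.sum_sub_distrib, Finset.sum_const, Finset.card_univ,
      Fintype.card_fin, nsmul_eq_mul]
    push_cast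
    ring
  have h0 : ∀ ψ : PureState d, (errProj ∅ ψ.1 * E (copies M ψ.1)).trace.re =
      ∑ r, ‖cEval ψ.1 (overlapPoly (K r))‖ ^ 2 := fun ψ => by
    rw [trace_errProj_kraus hK, Complex.re_sum]
    refine Finset.sum_congr rfl fun r _ => ?_
    rw [expect_errProj_empty, Complex.ofReal_re, cEval_overlapPoly]
  have h1 : ∀ n, ∀ ψ : PureState d, (errProj {n} ψ.1 * E (copies M ψ.1)).trace.re =
      ∑ i, ‖w n ψ i‖ ^ 2 := fun n ψ => by
    rw [trace_errProj_kraus hK, Complex.re_sum, Fintype.sum_prod_type]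
    refine Finset.sum_congr rfl fun r _ => ?_
    rw [expect_errProj_singleton _ _ (norm_pureState ψ), Complex.ofReal_re]
  have hcont : ∀ n, Continuous fun ψ : PureState d => ∑ i, ‖w n ψ i‖ ^ 2 := fun n => by
    have h := continuous_trace_errProj E {n}
    simpa only [h1] using h
  have gap : ((d : ℝ) - 1) * ∫ ψ, ∑ r, ‖cEval ψ.1 (overlapPoly (K r))‖ ^ 2 ∂sphereMeasure d ≤
      ∫ ψ, ∑ i, ‖∑ n, w n ψ i‖ ^ 2 ∂sphereMeasure d := by
    simp only [Fintype.sum_prod_type, hsum]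
    rw [integral_finsetSum, integral_finsetSum, Finset.mul_sum]
    · refine Finset.sum_le_sum fun r _ => spectral_gap hd ?_ ?_ ?_
      · convert overlapPoly_isHomogeneous (K r) using 1
        ring
      · simpa using overlapPoly_isWeightedHomogeneous (K r) 0 1
      · simpa using overlapPoly_isWeightedHomogeneous (K r) 1 0
    · refine fun r _ => integrable_sphere_of_continuous (continuous_finsetSum _ fun k _ => ?_)
      have hc : ∀ P : CPoly d, Continuous fun ψ : PureState d => cEval ψ.1 P :=
        continuous_cEval_sphere
      have hk : Continuous fun ψ : PureState d => ψ.1 k := by fun_prop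
      exact ((hc _).sub (hk.mul (continuous_const.mul (hc _)))).norm.pow 2
    · exact fun r _ => integrable_sphere_of_continuous ((continuous_cEval_sphere _).norm.pow 2)
  have mink := integral_sum_norm_sq_sum_le
    -- Minkowski is applied to the normalised measure so that its integrals are the averages
    -- defining `errProb`.
    ((sphereMeasure d Set.univ)⁻¹ • sphereMeasure d) w fun n =>
      (integrable_sphere_of_continuous (hcont n)).smul_measure
        (ENNReal.inv_ne_top.mpr (by simpa using sphereMeasure_ne_zero hd))
  simp only [errProb, h0, h1]
  refine le_trans ?_ mink
  change _ ≤ ⨍ ψ, ∑ i, ‖∑ n, w n ψ i‖ ^ 2 ∂sphereMeasure d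
  rw [average_eq, average_eq, smul_eq_mul, smul_eq_mul, mul_left_comm]
  exact mul_le_mul_of_nonneg_left gap (by positivity)

/-- The fidelities of any cloner are bounded by those of a point on or above the trade-off
curve. -/
theorem IsChannel.exists_amplitudes (hd : 2 ≤ d) {M : ℕ} {E : Op d M →ₗ[ℂ] Op d (M + 1)}
    (hE : IsChannel E) : ∃ x : Fin (M + 1) → ℝ, (∀ n, 0 ≤ x n) ∧
      (d : ℝ) ≤ (∑ n, x n) ^ 2 + ((d : ℝ) - 1) * ∑ n, x n ^ 2 ∧
      ∀ y, fidelity E y ≤ 1 - ((d : ℝ) - 1) / d * ∑ n ∈ y, x n ^ 2 := by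
  have hd' : (2 : ℝ) ≤ d := by exact_mod_cast hd
  have hd1 : (0 : ℝ) < d - 1 := by linarith
  have hq := firstErrProb_nonneg hE
  have hx : ∀ n, (√(d / (d - 1)) * √(firstErrProb E n)) ^ 2 =
      (d : ℝ) / (d - 1) * firstErrProb E n := fun n => by
    rw [mul_pow, Real.sq_sqrt (by positivity), Real.sq_sqrt (hq n)]
  -- First-error probabilities are used because they dominate the single-error ones, sum exactly to
  -- `1 - errProb E ∅`, and obey the bound for every `y`. Marginal error probabilities `1 - fidelity
  -- E {n}` would fail the last requirement, since patterns could be counted several times.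
  refine ⟨fun n => √(d / (d - 1)) * √(firstErrProb E n), fun n => by positivity, ?_, fun y => ?_⟩
  · simp only [hx]
    rw [← Finset.mul_sum, ← Finset.mul_sum, mul_pow, Real.sq_sqrt (by positivity),
      sum_firstErrProb hd hE]
    have h1 : (∑ n, √(errProb E {n})) ^ 2 ≤ (∑ n, √(firstErrProb E n)) ^ 2 := by
      gcongr with n
      exact errProb_singleton_le_firstErrProb hE n
    have h2 := (errProb_empty_le hd hE).trans h1
    calc (d : ℝ) = d / (d - 1) * ((d - 1) * errProb E ∅) +
          (d - 1) * (d / (d - 1) * (1 - errProb E ∅)) := by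
            field_simp
            ring
      _ ≤ _ := by gcongr
  · simp only [hx]
    rw [← Finset.mul_sum, ← mul_assoc, div_mul_div_cancel₀ (by positivity), div_self hd1.ne', one_mul]
    linarith [sum_firstErrProb_le hd hE y]

end TradeOffBound

/-! ### Construction of the cloners and their fidelities -/

section Cloner

variable {d : ℕ}

/-- The map `X ↦ ∑ᵣ Kᵣ X Kᵣ†`. -/
noncomputable def krausMap {m n ι : Type*} [Fintype m] [Fintype ι] (K : ι → Matrix n m ℂ) :
    Matrix m m ℂ →ₗ[ℂ] Matrix n n ℂ where
  toFun X := ∑ r, K r * X * (K r)ᴴ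
  map_add' X Y := by simp only [Matrix.mul_add, Matrix.add_mul, Finset.sum_add_distrib]
  map_smul' c X := by simp [Finset.smul_sum]

/-- The multiset of letters of a string. -/
def letters {n : ℕ} (a : Str d n) : Multiset (Fin d) := Finset.univ.val.map a

theorem letters_eq_cons {n : ℕ} (b : Str d (n + 1)) (m : Fin (n + 1)) :
    letters b = b m ::ₘ letters (m.removeNth b) := by
  simp only [letters, Fin.univ_succAbove n m, Finset.cons_val, Multiset.map_cons,
    Finset.map_val, Multiset.map_map]
  rfl

theorem tensorVec_eq_of_letters_eq {n : ℕ} {a b : Str d n} (h : letters a = letters b)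
    (ψ : EuclideanSpace ℂ (Fin d)) : tensorVec n ψ a = tensorVec n ψ b := by
  have hp : ∀ c : Str d n, tensorVec n ψ c = ((letters c).map fun k => ψ k).prod := fun c => by
    rw [letters, Multiset.map_map]
    rfl
  rw [hp, hp, h]

/-- The projection onto the symmetric subspace. -/
noncomputable def symProj (d n : ℕ) : Op d n :=
  Matrix.of fun a b => if letters a = letters b then
    ((Finset.univ.filter fun c : Str d n => letters c = letters b).card : ℂ)⁻¹ else 0

theorem symProj_apply_congr {n : ℕ} {a a' : Str d n} (h : letters a = letters a')
    (b : Str d n) : symProj d n a b = symProj d n a' b := by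
  simp only [symProj, Matrix.of_apply, h]

theorem symProj_conjTranspose (d n : ℕ) : (symProj d n)ᴴ = symProj d n := by
  ext a b
  simp only [symProj, Matrix.conjTranspose_apply, Matrix.of_apply, eq_comm (a := letters b)]
  split_ifs with h
  · simp [h]
  · simp

/-- Each row of `symProj` averages over the strings with the same letters, and such an average fixes
a function depending on the letters alone. -/
theorem symProj_mul_of_invariant {n : ℕ} (u : Str d n → ℂ)
    (hu : ∀ a b, letters a = letters b → u a = u b) (a : Str d n) :
    ∑ b, symProj d n a b * u b = u a := by
  have hcard : ((Finset.univ.filter fun c : Str d n => letters c = letters a).card : ℂ) ≠ 0 := by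
    exact_mod_cast (Finset.card_pos.mpr ⟨a, by simp⟩).ne'
  have h : ∀ b, symProj d n a b * u b = if letters b = letters a then
      ((Finset.univ.filter fun c : Str d n => letters c = letters a).card : ℂ)⁻¹ * u a
        else 0 := fun b => by
    simp only [symProj, Matrix.of_apply, eq_comm (a := letters b)]
    split_ifs with h
    · rw [hu a b h, h]
    · simp
  rw [Finset.sum_congr rfl fun b _ => h b, ← Finset.sum_filter, Finset.sum_const, nsmul_eq_mul,
    mul_inv_cancel_left₀ hcard]

theorem symProj_mul_self (d n : ℕ) : symProj d n * symProj d n = symProj d n := by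
  ext a c
  exact symProj_mul_of_invariant (fun b => symProj d n b c)
    (fun a b h => symProj_apply_congr h c) a

theorem symProj_mulVec_tensorVec {n : ℕ} (ψ : EuclideanSpace ℂ (Fin d)) :
    symProj d n *ᵥ tensorVec n ψ = tensorVec n ψ := by
  ext a
  exact symProj_mul_of_invariant _ (fun a b h => tensorVec_eq_of_letters_eq h ψ) a

theorem clonerKraus_mulVec {M : ℕ} (β : Fin (M + 1) → ℝ) (i : Fin d) (u : Str d M → ℂ)
    (b : Str d (M + 1)) : (clonerKraus β i *ᵥ u) b =
      ((√d)⁻¹ : ℝ) * ∑ n, if b n = i then (β n : ℂ) * u (n.removeNth b) else 0 := by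
  simp only [Matrix.mulVec, dotProduct, clonerKraus, Matrix.of_apply, Complex.ofReal_mul,
    Complex.ofReal_sum, mul_assoc, ← Finset.mul_sum, Finset.sum_mul]
  rw [Finset.sum_comm]
  congr 1
  refine Finset.sum_congr rfl fun n _ => ?_
  split_ifs with h
  · simp [h, apply_ite Complex.ofReal, ite_mul]
  · simp [h]

theorem clonerKraus_conjTranspose_mulVec {M : ℕ} (β : Fin (M + 1) → ℝ) (i : Fin d)
    (u : Str d (M + 1) → ℂ) (a : Str d M) : ((clonerKraus β i)ᴴ *ᵥ u) a =
      ((√d)⁻¹ : ℝ) * ∑ n, (β n : ℂ) * u (n.insertNth i a) := by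
  have hstar : ∀ b, star (clonerKraus β i b a) = clonerKraus β i b a := fun b =>
    Complex.conj_ofReal _
  simp only [Matrix.mulVec, dotProduct, Matrix.conjTranspose_apply, hstar]
  simp only [clonerKraus, Matrix.of_apply, Complex.ofReal_mul, Complex.ofReal_sum, mul_assoc, ← Finset.mul_sum, Finset.sum_mul]
  rw [Finset.sum_comm]
  congr 1
  refine Finset.sum_congr rfl fun n _ => ?_
  have h : ∀ b : Str d (M + 1), (b n = i ∧ n.removeNth b = a) ↔ b = n.insertNth i a := fun b => by
    rw [Fin.eq_insertNth_iff]
  simp [h, apply_ite Complex.ofReal, ite_mul]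

theorem sum_sum_mul_ite {N : ℕ} (β : Fin N → ℂ) (c : Fin N → ℂ) :
    ∑ n, ∑ m, β n * β m * (if n = m then c n else 1) =
      (∑ n, β n) ^ 2 + ∑ n, β n ^ 2 * (c n - 1) := by
  have h : ∀ n m, β n * β m * (if n = m then c n else 1) =
      β n * β m + if n = m then β n ^ 2 * (c n - 1) else 0 := fun n m => by
    split_ifs with h
    · rw [← h]
      ring
    · ring
  simp only [h, Finset.sum_add_distrib, Finset.sum_ite_eq, Finset.mem_univ, if_true, sq,
    Finset.sum_mul_sum]

theorem inv_sqrt_mul_inv_sqrt (d : ℕ) :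
    (((√d)⁻¹ : ℝ) : ℂ) * (((√d)⁻¹ : ℝ) : ℂ) = (d : ℂ)⁻¹ := by
  rw [← Complex.ofReal_mul, ← mul_inv, Real.mul_self_sqrt (Nat.cast_nonneg d)]
  simp

theorem normalised_complex {N : ℕ} {β : Fin N → ℝ} (hβ : Normalised d β) :
    (∑ n, (β n : ℂ)) ^ 2 + ((d : ℂ) - 1) * ∑ n, (β n : ℂ) ^ 2 = d := by
  unfold Normalised at hβ
  exact_mod_cast hβ

/-- On the symmetric subspace the cloner preserves the trace. -/
theorem sum_clonerKraus_mul_symProj (hd : 2 ≤ d) {M : ℕ} {β : Fin (M + 1) → ℝ}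
    (hβ : Normalised d β) :
    (∑ i : Fin d, (clonerKraus β i)ᴴ * clonerKraus β i) * symProj d M = symProj d M := by
  have hd0 : (d : ℂ) ≠ 0 := by exact_mod_cast (by omega : d ≠ 0)
  ext a c
  set u : Str d M → ℂ := fun b => symProj d M b c with hu
  have h1 : ((∑ i : Fin d, (clonerKraus β i)ᴴ * clonerKraus β i) * symProj d M) a c =
      ∑ i : Fin d, ((clonerKraus β i)ᴴ *ᵥ (clonerKraus β i *ᵥ u)) a := by
    rw [Finset.sum_mul, Matrix.sum_apply]
    refine Finset.sum_congr rfl fun i _ => ?_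
    rw [Matrix.mulVec_mulVec]
    rfl
  -- Inserting `i` at `n` and removing an equal letter at `m` only permutes the letters of `a`,
  -- which a symmetric `u` does not notice.
  have h2 : ∀ (n m : Fin (M + 1)) (i : Fin d),
      (if (n.insertNth i a : Str d (M + 1)) m = i then
        (β m : ℂ) * u (m.removeNth (n.insertNth i a : Str d (M + 1))) else 0) =
      if (n.insertNth i a : Str d (M + 1)) m = i then (β m : ℂ) * u a else 0 := fun n m i => by
    split_ifs with h
    · congr 1
      refine symProj_apply_congr ?_ c
      have e1 := letters_eq_cons (n.insertNth i a : Str d (M + 1)) n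
      have e2 := letters_eq_cons (n.insertNth i a : Str d (M + 1)) m
      rw [Fin.insertNth_apply_same, Fin.removeNth_insertNth] at e1
      rw [h, e1] at e2
      exact ((Multiset.cons_inj_right i).mp e2).symm
    · rfl
  -- For `n = m` every letter `i` contributes; for `n ≠ m` only the one already sitting at site `m`.
  -- These counts `d` and `1` produce the quadratic form in the normalisation condition.
  have h3 : ∀ n m : Fin (M + 1), ∑ i : Fin d,
      (if (n.insertNth i a : Str d (M + 1)) m = i then (β m : ℂ) * u a else 0) =
      (β m : ℂ) * (if n = m then (d : ℂ) else 1) * u a := fun n m => by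
    by_cases h : n = m
    · subst h
      simp only [Fin.insertNth_apply_same, if_true, Finset.sum_const, Finset.card_univ,
        Fintype.card_fin, nsmul_eq_mul]
      ring
    · obtain ⟨j, rfl⟩ := Fin.exists_succAbove_eq (Ne.symm h)
      simp [Fin.insertNth_apply_succAbove, h]
  rw [h1]
  simp only [clonerKraus_conjTranspose_mulVec, clonerKraus_mulVec, h2, Finset.mul_sum]
  simp only [← Finset.mul_sum]
  rw [Finset.sum_comm]
  have h4 : ∀ n, ∑ i : Fin d, (β n : ℂ) * ((((√d)⁻¹ : ℝ) : ℂ) * ∑ m,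
      if (n.insertNth i a : Str d (M + 1)) m = i then (β m : ℂ) * u a else 0) =
      (((√d)⁻¹ : ℝ) : ℂ) * ∑ m, (β n * β m * (if n = m then (d : ℂ) else 1)) * u a := fun n => by
    rw [← Finset.mul_sum, ← Finset.mul_sum, Finset.sum_comm, mul_left_comm, Finset.mul_sum]
    congr 1
    refine Finset.sum_congr rfl fun m _ => ?_
    rw [h3]
    ring
  rw [Finset.sum_congr rfl fun n _ => h4 n, ← Finset.mul_sum, ← mul_assoc, inv_sqrt_mul_inv_sqrt]
  simp only [← Finset.sum_mul]
  rw [sum_sum_mul_ite (fun n => (β n : ℂ)) fun _ => (d : ℂ), ← Finset.sum_mul]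
  have hnorm : (∑ n, (β n : ℂ)) ^ 2 + (∑ n, (β n : ℂ) ^ 2) * ((d : ℂ) - 1) = d := by
    linear_combination normalised_complex hβ
  rw [hnorm, inv_mul_cancel_left₀ hd0]

/-- Every normalised amplitude vector defines a cloner. -/
theorem exists_cloner (hd : 2 ≤ d) {M : ℕ} {β : Fin (M + 1) → ℝ} (hβ : Normalised d β) :
    ∃ E : Op d M →ₗ[ℂ] Op d (M + 1), IsChannel E ∧
      ∀ ψ : EuclideanSpace ℂ (Fin d), E (copies M ψ) = clonerOutput β ψ := by
  let b₀ : Str d (M + 1) := fun _ => ⟨0, by omega⟩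
  -- The operators `clonerKraus β i` are known to resolve the identity only on the symmetric
  -- subspace. The second family sends the complement to the fixed state `b₀`; it restores trace
  -- preservation and annihilates `ψ^{⊗M}`.
  let K : Fin d ⊕ Str d M → Matrix (Str d (M + 1)) (Str d M) ℂ :=
    Sum.elim (fun i => clonerKraus β i * symProj d M)
      fun j => Matrix.single b₀ j (1 : ℂ) * (1 - symProj d M)
  refine ⟨krausMap K, isChannel_of_kraus K (fun X => rfl) ?_, fun ψ => ?_⟩
  · rw [Fintype.sum_sum_type]
    have h1 : ∑ i, (K (Sum.inl i))ᴴ * K (Sum.inl i) = symProj d M := by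
      simp only [K, Sum.elim_inl, Matrix.conjTranspose_mul, symProj_conjTranspose]
      calc _ = symProj d M *
            ((∑ i : Fin d, (clonerKraus β i)ᴴ * clonerKraus β i) * symProj d M) := by
            rw [Finset.sum_mul, Finset.mul_sum]
            simp only [Matrix.mul_assoc]
        _ = _ := by rw [sum_clonerKraus_mul_symProj hd hβ, symProj_mul_self]
    have h2 : ∑ j, (K (Sum.inr j))ᴴ * K (Sum.inr j) = 1 - symProj d M := by
      simp only [K, Sum.elim_inr, Matrix.conjTranspose_mul, Matrix.conjTranspose_sub,
        Matrix.conjTranspose_one, symProj_conjTranspose, Matrix.conjTranspose_single, star_one]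
      calc _ = (1 - symProj d M) * ((∑ j : Str d M, Matrix.single j j (1 : ℂ)) *
            (1 - symProj d M)) := by
            rw [Finset.sum_mul, Finset.mul_sum]
            refine Finset.sum_congr rfl fun j _ => ?_
            rw [Matrix.mul_assoc, ← Matrix.mul_assoc (Matrix.single j b₀ (1 : ℂ)),
              Matrix.single_mul_single_same, mul_one]
        _ = _ := by
            have h : ∑ j : Str d M, Matrix.single j j (1 : ℂ) = 1 := by
              ext a b
              simp [Matrix.sum_apply, Matrix.single_apply, Matrix.one_apply, ite_and]
            rw [h, one_mul, sub_mul, mul_sub, mul_sub, symProj_mul_self]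
            simp
    rw [h1, h2, add_sub_cancel]
  · have h : ∀ r, K r * copies M ψ * (K r)ᴴ = Matrix.vecMulVec (K r *ᵥ tensorVec M ψ)
        (star (K r *ᵥ tensorVec M ψ)) := fun r => by
      rw [copies_eq_vecMulVec, Matrix.mul_vecMulVec, Matrix.vecMulVec_mul, ← Matrix.star_mulVec]
    change ∑ r, K r * copies M ψ * (K r)ᴴ = _
    rw [Fintype.sum_sum_type, clonerOutput, Finset.sum_eq_zero (s := Finset.univ)
      (f := fun j => K (Sum.inr j) * copies M ψ * (K (Sum.inr j))ᴴ), add_zero]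
    · refine Finset.sum_congr rfl fun i _ => ?_
      rw [h, copies_eq_vecMulVec, Matrix.mul_vecMulVec, Matrix.vecMulVec_mul,
        ← Matrix.star_mulVec]
      simp only [K, Sum.elim_inl, ← Matrix.mulVec_mulVec, symProj_mulVec_tensorVec]
    · intro j _
      rw [h]
      simp only [K, Sum.elim_inr, ← Matrix.mulVec_mulVec, Matrix.sub_mulVec, Matrix.one_mulVec,
        symProj_mulVec_tensorVec, sub_self, Matrix.mulVec_zero, Matrix.zero_vecMulVec]

theorem star_dotProduct_siteOp_mulVec {n : ℕ} (T : Fin n → Matrix (Fin d) (Fin d) ℂ)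
    (g h : Fin n → Fin d → ℂ) :
    star (fun b : Str d n => ∏ j, g j (b j)) ⬝ᵥ (siteOp T *ᵥ fun b => ∏ j, h j (b j)) =
      ∏ j, star (g j) ⬝ᵥ (T j *ᵥ h j) := by
  simp only [dotProduct, Matrix.mulVec, siteOp, Matrix.of_apply, Pi.star_apply, star_prod,
    ← Finset.prod_mul_distrib]
  rw [Fintype.prod_sum]
  refine Finset.sum_congr rfl fun a _ => ?_
  rw [Finset.prod_mul_distrib, Fintype.prod_sum]

theorem clonerKraus_mulVec_tensorVec {M : ℕ} (β : Fin (M + 1) → ℝ) (i : Fin d)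
    (ψ : EuclideanSpace ℂ (Fin d)) : clonerKraus β i *ᵥ tensorVec M ψ =
      (((√d)⁻¹ : ℝ) : ℂ) • ∑ n, (β n : ℂ) • fun b : Str d (M + 1) =>
        ∏ j, (if j = n then Pi.single i 1 else fun k => ψ k : Fin d → ℂ) (b j) := by
  ext b
  rw [clonerKraus_mulVec]
  simp only [Pi.smul_apply, Finset.sum_apply, smul_eq_mul]
  congr 1
  refine Finset.sum_congr rfl fun n _ => ?_
  rw [Fin.prod_univ_succAbove _ n]
  simp only [if_true, Fin.succAbove_ne, if_false, Pi.single_apply]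
  split_ifs
  · simp [tensorVec, Fin.removeNth]
  · simp

theorem ketbra_mulVec {ψ : EuclideanSpace ℂ (Fin d)} (hψ : ‖ψ‖ = 1) :
    (ketbra ψ *ᵥ fun k => ψ k) = fun k => ψ k := by
  ext k
  simp only [ketbra, Matrix.mulVec, dotProduct, Matrix.of_apply, mul_assoc, ← Finset.mul_sum]
  rw [sum_conj_mul_self hψ, mul_one]

/-- For `n = m` the sum over `i` is the trace of the operator at site `n`. For `n ≠ m` both sites
give overlaps of `ψ` with the basis state `i`, and the sum is `‖ψ‖² = 1`, whatever `y` is. -/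
theorem sum_expect_siteOp {N : ℕ} (y : Finset (Fin N)) {ψ : EuclideanSpace ℂ (Fin d)}
    (hψ : ‖ψ‖ = 1) (n m : Fin N) :
    ∑ i : Fin d, ∏ j, star (if j = n then Pi.single i 1 else fun k => ψ k : Fin d → ℂ) ⬝ᵥ
      ((if j ∈ y then ketbra ψ else 1) *ᵥ
        (if j = m then Pi.single i 1 else fun k => ψ k : Fin d → ℂ)) =
      if n = m then (if n ∈ y then 1 else d : ℂ) else 1 := by
  have hT : ∀ j : Fin N, ((if j ∈ y then ketbra ψ else 1) *ᵥ fun k => ψ k) = fun k => ψ k :=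
    fun j => by
      split_ifs
      · exact ketbra_mulVec hψ
      · exact Matrix.one_mulVec _
  have hTH : ∀ j : Fin N, (if j ∈ y then ketbra ψ else 1)ᴴ = if j ∈ y then ketbra ψ else 1 :=
    fun j => by
      split_ifs
      · exact ketbra_conjTranspose ψ
      · exact Matrix.conjTranspose_one
  have hψψ : star (fun k => ψ k) ⬝ᵥ (fun k => ψ k : Fin d → ℂ) = 1 := sum_conj_mul_self hψ
  have hother : ∀ (i : Fin d) j, j ≠ n → j ≠ m →
      star (if j = n then Pi.single i 1 else fun k => ψ k : Fin d → ℂ) ⬝ᵥ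
      ((if j ∈ y then ketbra ψ else 1) *ᵥ
        (if j = m then Pi.single i 1 else fun k => ψ k : Fin d → ℂ)) = 1 := fun i j hn hm => by
    rw [if_neg hn, if_neg hm, hT, hψψ]
  by_cases h : n = m
  · subst h
    have h1 : ∀ i : Fin d, ∏ j, star (if j = n then Pi.single i 1 else fun k => ψ k : Fin d → ℂ) ⬝ᵥ
      ((if j ∈ y then ketbra ψ else 1) *ᵥ
        (if j = n then Pi.single i 1 else fun k => ψ k : Fin d → ℂ)) =
        (if n ∈ y then ketbra ψ else 1) i i := fun i => by
      rw [Fintype.prod_eq_single n fun j hj => hother i j hj hj]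
      simp
    rw [Finset.sum_congr rfl fun i _ => h1 i, if_pos rfl]
    split_ifs
    · simpa [ketbra, mul_comm] using sum_conj_mul_self hψ
    · simp
  · have h1 : ∀ i : Fin d, ∏ j, star (if j = n then Pi.single i 1 else fun k => ψ k : Fin d → ℂ) ⬝ᵥ
      ((if j ∈ y then ketbra ψ else 1) *ᵥ
        (if j = m then Pi.single i 1 else fun k => ψ k : Fin d → ℂ)) =
        conj (ψ i) * ψ i := fun i => by
      rw [Fintype.prod_eq_mul n m h fun j hj => hother i j hj.1 hj.2]
      rw [if_pos rfl, if_neg h, hT, if_neg (Ne.symm h), if_pos rfl, Matrix.dotProduct_mulVec,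
        ← hTH, ← Matrix.star_mulVec, hT]
      simp [mul_comm]
    rw [Finset.sum_congr rfl fun i _ => h1 i, if_neg h, sum_conj_mul_self hψ]

theorem trace_siteProj_mul_clonerOutput (hd : 2 ≤ d) {M : ℕ} {β : Fin (M + 1) → ℝ}
    (hβ : Normalised d β) (y : Finset (Fin (M + 1))) {ψ : EuclideanSpace ℂ (Fin d)}
    (hψ : ‖ψ‖ = 1) : (siteProj y ψ * clonerOutput β ψ).trace =
      ((1 - ((d : ℝ) - 1) / d * ∑ n ∈ y, β n ^ 2 : ℝ) : ℂ) := by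
  have hd0 : (d : ℂ) ≠ 0 := by exact_mod_cast (by omega : d ≠ 0)
  rw [clonerOutput, copies_eq_vecMulVec, trace_mul_kraus_vecMulVec, siteProj_eq_siteOp]
  simp only [clonerKraus_mulVec_tensorVec, Matrix.mulVec_smul, Matrix.mulVec_sum, star_smul,
    star_sum, smul_dotProduct, dotProduct_smul, sum_dotProduct, dotProduct_sum,
    star_dotProduct_siteOp_mulVec, smul_eq_mul, RCLike.star_def, Complex.conj_ofReal]
  rw [← Finset.mul_sum, Finset.sum_comm]
  have h1 : ∀ m, ∑ i : Fin d, (β m : ℂ) * ((((√d)⁻¹ : ℝ) : ℂ) * ∑ n, (β n : ℂ) *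
      ∏ j, star (if j = n then Pi.single i 1 else fun k => ψ k : Fin d → ℂ) ⬝ᵥ
        ((if j ∈ y then ketbra ψ else 1) *ᵥ
          (if j = m then Pi.single i 1 else fun k => ψ k : Fin d → ℂ))) =
      (((√d)⁻¹ : ℝ) : ℂ) * ∑ n, (β m : ℂ) * β n *
        if m = n then (if m ∈ y then 1 else d : ℂ) else 1 := fun m => by
    rw [← Finset.mul_sum, ← Finset.mul_sum, Finset.sum_comm, mul_left_comm, Finset.mul_sum]
    congr 1
    refine Finset.sum_congr rfl fun n _ => ?_
    rw [← Finset.mul_sum, sum_expect_siteOp y hψ, mul_assoc]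
    by_cases h : n = m
    · subst h
      rfl
    · rw [if_neg h, if_neg (Ne.symm h)]
  rw [Finset.sum_congr rfl fun m _ => h1 m, ← Finset.mul_sum, ← mul_assoc, inv_sqrt_mul_inv_sqrt,
    sum_sum_mul_ite (fun n => (β n : ℂ)) fun n => if n ∈ y then 1 else (d : ℂ)]
  have h2 : ∀ n, (β n : ℂ) ^ 2 * ((if n ∈ y then 1 else (d : ℂ)) - 1) =
      ((d : ℂ) - 1) * (β n : ℂ) ^ 2 - if n ∈ y then ((d : ℂ) - 1) * (β n : ℂ) ^ 2 else 0 :=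
    fun n => by split_ifs <;> ring
  simp only [h2, Finset.sum_sub_distrib, Finset.sum_ite_mem, Finset.univ_inter, ← Finset.mul_sum]
  rw [← add_sub_assoc, normalised_complex hβ]
  push_cast
  field_simp

theorem exists_cloner_fidelity (hd : 2 ≤ d) {M : ℕ} {β : Fin (M + 1) → ℝ}
    (hβ : Normalised d β) : ∃ E : Op d M →ₗ[ℂ] Op d (M + 1), IsChannel E ∧
      (∀ ψ : PureState d, E (copies M ψ.1) = clonerOutput β ψ.1) ∧
      ∀ y, fidelity E y = 1 - ((d : ℝ) - 1) / d * ∑ n ∈ y, β n ^ 2 := by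
  obtain ⟨E, hE, hEβ⟩ := exists_cloner hd hβ
  have : NeZero (sphereMeasure d) := ⟨sphereMeasure_ne_zero hd⟩
  refine ⟨E, hE, fun ψ => hEβ ψ.1, fun y => ?_⟩
  simp only [fidelity, hEβ, trace_siteProj_mul_clonerOutput hd hβ y (norm_pureState _),
    Complex.ofReal_re]
  exact average_const _ _

end Cloner

/-! ### Optimality, the trade-off surface and convex minimisation -/

section TradeOff

variable {d : ℕ}

/-- The form is homogeneous of degree two, so scaling by `√(d / Q) ≤ 1` reaches the value `d`
exactly. -/
theorem exists_normalised_le (hd : 2 ≤ d) {N : ℕ} {x : Fin N → ℝ} (hx : ∀ n, 0 ≤ x n)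
    (h : (d : ℝ) ≤ (∑ n, x n) ^ 2 + ((d : ℝ) - 1) * ∑ n, x n ^ 2) :
    ∃ β : Fin N → ℝ, (∀ n, 0 ≤ β n) ∧ Normalised d β ∧ ∀ n, β n ≤ x n := by
  have hd0 : (0 : ℝ) < d := by exact_mod_cast (by omega : 0 < d)
  set Q := (∑ n, x n) ^ 2 + ((d : ℝ) - 1) * ∑ n, x n ^ 2 with hQ
  have hQ0 : 0 < Q := hd0.trans_le h
  have hc1 : √(d / Q) ≤ 1 := Real.sqrt_le_one.mpr ((div_le_one hQ0).mpr h)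
  refine ⟨fun n => √(d / Q) * x n, fun n => mul_nonneg (Real.sqrt_nonneg _) (hx n), ?_,
    fun n => mul_le_of_le_one_left (hx n) hc1⟩
  simp only [Normalised, mul_pow, ← Finset.mul_sum, Real.sq_sqrt (div_pos hd0 hQ0).le]
  calc _ = d / Q * Q := by rw [hQ]; ring
    _ = d := div_mul_cancel₀ _ hQ0.ne'

/-- Keeping only the `n`-th terms in the normalisation condition leaves `d β_n² ≤ d`. This is what
puts the fidelities of a normalised vector in `[0, 1]`. -/
theorem Normalised.sq_le_one (hd : 2 ≤ d) {N : ℕ} {β : Fin N → ℝ} (hβ0 : ∀ n, 0 ≤ β n)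
    (hβ : Normalised d β) (n : Fin N) : β n ^ 2 ≤ 1 := by
  have hd' : (2 : ℝ) ≤ d := by exact_mod_cast hd
  have h1 : β n ≤ ∑ m, β m := Finset.single_le_sum (fun m _ => hβ0 m) (Finset.mem_univ n)
  have h2 : β n ^ 2 ≤ ∑ m, β m ^ 2 :=
    Finset.single_le_sum (f := fun m => β m ^ 2) (fun m _ => sq_nonneg _) (Finset.mem_univ n)
  have h3 : β n ^ 2 ≤ (∑ m, β m) ^ 2 := pow_le_pow_left₀ (hβ0 n) h1 2
  unfold Normalised at hβ
  nlinarith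

/-- A smaller vector above the normalisation threshold equals the normalised one. -/
theorem Normalised.sq_le_of_le (hd : 2 ≤ d) {N : ℕ} {β x : Fin N → ℝ} (hβ : Normalised d β)
    (hx0 : ∀ n, 0 ≤ x n) (hx : (d : ℝ) ≤ (∑ n, x n) ^ 2 + ((d : ℝ) - 1) * ∑ n, x n ^ 2)
    (hle : ∀ n, x n ≤ β n) (n : Fin N) : β n ^ 2 ≤ x n ^ 2 := by
  have hd' : (2 : ℝ) ≤ d := by exact_mod_cast hd
  have h1 : (∑ m, x m) ^ 2 ≤ (∑ m, β m) ^ 2 :=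
    pow_le_pow_left₀ (Finset.sum_nonneg fun m _ => hx0 m) (Finset.sum_le_sum fun m _ => hle m) 2
  have h2 : ∀ m ∈ Finset.univ, 0 ≤ β m ^ 2 - x m ^ 2 := fun m _ =>
    sub_nonneg.mpr (pow_le_pow_left₀ (hx0 m) (hle m) 2)
  have h3 := Finset.single_le_sum h2 (Finset.mem_univ n)
  rw [Finset.sum_sub_distrib] at h3
  unfold Normalised at hβ
  nlinarith

/-- The dictionary between amplitudes and fidelities: normalisation is equivalent to trade-off value
`M`, and a larger form means a smaller trade-off. Non-negativity is needed to have `√(x²) = x`. -/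
theorem tradeOff_of_amplitudes (hd : 2 ≤ d) {M : ℕ} {x : Fin (M + 1) → ℝ} (hx : ∀ n, 0 ≤ x n) :
    (∑ n, x n) ^ 2 + ((d : ℝ) - 1) * ∑ n, x n ^ 2 =
      d * (M + 1 - tradeOff d fun n => 1 - ((d : ℝ) - 1) / d * x n ^ 2) := by
  have hd' : (2 : ℝ) ≤ d := by exact_mod_cast hd
  have hd1 : (0 : ℝ) < d - 1 := by linarith
  have hd0 : (0 : ℝ) < d := by linarith
  have hs : ∀ n, √(((d : ℝ) - 1) / d * x n ^ 2) = √(((d : ℝ) - 1) / d) * x n := fun n => by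
    rw [Real.sqrt_mul (by positivity), Real.sqrt_sq (hx n)]
  simp only [tradeOff, sub_sub_cancel, hs, ← Finset.mul_sum, mul_pow,
    Real.sq_sqrt (by positivity : 0 ≤ ((d : ℝ) - 1) / d), Finset.sum_sub_distrib, Finset.sum_const,
    Finset.card_univ, Fintype.card_fin, nsmul_eq_mul, mul_one]
  push_cast
  field_simp
  ring

theorem exists_amplitudes_of_le_one (hd : 2 ≤ d) {N : ℕ} {F : Fin N → ℝ} (hF : ∀ n, F n ≤ 1) :
    ∃ x : Fin N → ℝ, (∀ n, 0 ≤ x n) ∧ F = fun n => 1 - ((d : ℝ) - 1) / d * x n ^ 2 := by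
  have hd' : (2 : ℝ) ≤ d := by exact_mod_cast hd
  have hd1 : (0 : ℝ) < d - 1 := by linarith
  have hd0 : (0 : ℝ) < d := by linarith
  refine ⟨fun n => √(d / (d - 1) * (1 - F n)), fun n => Real.sqrt_nonneg _, funext fun n => ?_⟩
  have : 0 ≤ 1 - F n := sub_nonneg.mpr (hF n)
  rw [Real.sq_sqrt (by positivity)]
  field_simp
  ring

/-- A competitor at least as good yields amplitudes `x ≤ β` still at or above the normalisation
threshold. As the form is strictly increasing on non-negative vectors, this forces `x = β`. -/
theorem isOptimalCloner_of_fidelity (hd : 2 ≤ d) {M : ℕ} {β : Fin (M + 1) → ℝ}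
    (hβ0 : ∀ n, 0 ≤ β n) (hβ : Normalised d β) {E : Op d M →ₗ[ℂ] Op d (M + 1)}
    (hE : IsChannel E) (hF : ∀ n, fidelity E {n} = 1 - ((d : ℝ) - 1) / d * β n ^ 2) :
    IsOptimalCloner E := by
  have hd' : (2 : ℝ) ≤ d := by exact_mod_cast hd
  have hc : (0 : ℝ) < ((d : ℝ) - 1) / d := div_pos (by linarith) (by linarith)
  refine ⟨hE, fun E' hE' hle n => ?_⟩
  obtain ⟨x, hx0, hx, hxF⟩ := hE'.exists_amplitudes hd
  have hxF' : ∀ n, fidelity E' {n} ≤ 1 - ((d : ℝ) - 1) / d * x n ^ 2 := fun n => by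
    simpa using hxF {n}
  have hxβ : ∀ n, x n ≤ β n := fun n => by
    have h := (hle n).trans (hxF' n)
    rw [hF, sub_le_sub_iff_left] at h
    exact (pow_le_pow_iff_left₀ (hx0 n) (hβ0 n) two_ne_zero).mp (le_of_mul_le_mul_left h hc)
  have h := hβ.sq_le_of_le hd hx0 hx hxβ n
  rw [hF]
  exact (hxF' n).trans (sub_le_sub_left (mul_le_mul_of_nonneg_left h hc.le) _)

/-- The fidelities of any cloner are dominated by those of a normalised amplitude vector. -/
theorem IsChannel.exists_normalised (hd : 2 ≤ d) {M : ℕ} {E : Op d M →ₗ[ℂ] Op d (M + 1)}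
    (hE : IsChannel E) : ∃ β : Fin (M + 1) → ℝ, (∀ n, 0 ≤ β n) ∧ Normalised d β ∧
      ∀ y, fidelity E y ≤ 1 - ((d : ℝ) - 1) / d * ∑ n ∈ y, β n ^ 2 := by
  have hd' : (2 : ℝ) ≤ d := by exact_mod_cast hd
  have hc : (0 : ℝ) < ((d : ℝ) - 1) / d := div_pos (by linarith) (by linarith)
  obtain ⟨x, hx0, hx, hxF⟩ := hE.exists_amplitudes hd
  obtain ⟨β, hβ0, hβ, hβx⟩ := exists_normalised_le hd hx0 hx
  refine ⟨β, hβ0, hβ, fun y => (hxF y).trans (sub_le_sub_left (mul_le_mul_of_nonneg_left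
    (Finset.sum_le_sum fun n _ => pow_le_pow_left₀ (hβ0 n) (hβx n) 2) hc.le) _)⟩

/-- Optimality against the explicit cloner that dominates `E` forces equality at single sites. The
joint fidelities are then squeezed between the domination bound and the union bound. -/
theorem IsOptimalCloner.exists_normalised (hd : 2 ≤ d) {M : ℕ} {E : Op d M →ₗ[ℂ] Op d (M + 1)}
    (hE : IsOptimalCloner E) : ∃ β : Fin (M + 1) → ℝ, (∀ n, 0 ≤ β n) ∧ Normalised d β ∧
      (∀ k, fidelity E {k} = 1 - ((d : ℝ) - 1) / d * β k ^ 2) ∧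
      ∀ y, fidelity E y = 1 - ((d : ℝ) - 1) / d * ∑ n ∈ y, β n ^ 2 := by
  obtain ⟨β, hβ0, hβ, hle⟩ := hE.1.exists_normalised hd
  obtain ⟨E', hE', -, hF'⟩ := exists_cloner_fidelity hd hβ
  have hF : ∀ k, fidelity E {k} = 1 - ((d : ℝ) - 1) / d * β k ^ 2 := fun k => by
    have h1 := hE.2 E' hE' (fun n => (hF' {n}).symm ▸ hle {n}) k
    rw [hF'] at h1
    simpa using le_antisymm (hle {k}) h1
  refine ⟨β, hβ0, hβ, hF, fun y => le_antisymm (hle y) ?_⟩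
  have h := one_sub_fidelity_le_sum hd hE.1 y
  simp only [hF, sub_sub_cancel, ← Finset.mul_sum] at h
  linarith

theorem exists_isOptimalCloner_iff (hd : 2 ≤ d) {M : ℕ} (F : Fin (M + 1) → ℝ) :
    (∃ E : Op d M →ₗ[ℂ] Op d (M + 1), IsOptimalCloner E ∧ ∀ n, fidelity E {n} = F n) ↔
      (∀ n, F n ≤ 1) ∧ (M : ℝ) = tradeOff d F := by
  have hd0 : (0 : ℝ) < d := by exact_mod_cast (by omega : 0 < d)
  constructor
  · rintro ⟨E, hE, hEF⟩
    obtain ⟨β, hβ0, hβ, hF, -⟩ := hE.exists_normalised hd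
    have hFβ : F = fun n => 1 - ((d : ℝ) - 1) / d * β n ^ 2 := funext fun n => by
      rw [← hEF, hF]
    refine ⟨fun n => hEF n ▸ fidelity_le_one hd hE.1 {n}, ?_⟩
    have h := tradeOff_of_amplitudes hd hβ0
    rw [show _ = (d : ℝ) from hβ, ← hFβ] at h
    have : (M : ℝ) + 1 - tradeOff d F = 1 := mul_left_cancel₀ hd0.ne' (by rw [← h, mul_one])
    linarith
  · rintro ⟨hF1, hF⟩
    obtain ⟨x, hx0, rfl⟩ := exists_amplitudes_of_le_one hd hF1
    have hx : Normalised d x := by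
      rw [Normalised, tradeOff_of_amplitudes hd hx0, ← hF]
      ring
    obtain ⟨E, hE, -, hEF⟩ := exists_cloner_fidelity hd hx
    have hEF' : ∀ n, fidelity E {n} = 1 - ((d : ℝ) - 1) / d * x n ^ 2 := fun n => by
      simpa using hEF {n}
    exact ⟨E, isOptimalCloner_of_fidelity hd hx0 hx hE hEF', hEF'⟩

/-- Cauchy–Schwarz in the plane, with defect `a b (√u √v' - √u' √v)²`. -/
theorem sqrt_mul_sqrt_concave {a b u u' v v' : ℝ} (ha : 0 ≤ a) (hb : 0 ≤ b) (hu : 0 ≤ u)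
    (hu' : 0 ≤ u') (hv : 0 ≤ v) (hv' : 0 ≤ v') :
    a * (√u * √v) + b * (√u' * √v') ≤ √(a * u + b * u') * √(a * v + b * v') := by
  rw [← Real.sqrt_mul (x := a * u + b * u') (by positivity)]
  refine Real.le_sqrt_of_sq_le ?_
  have h : (a * u + b * u') * (a * v + b * v') - (a * (√u * √v) + b * (√u' * √v')) ^ 2 =
      a * b * (√u * √v' - √u' * √v) ^ 2 := by
    conv_lhs => rw [← Real.sq_sqrt hu, ← Real.sq_sqrt hu', ← Real.sq_sqrt hv, ← Real.sq_sqrt hv']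
    simp only [Real.sqrt_sq (Real.sqrt_nonneg _)]
    ring
  have : 0 ≤ a * b * (√u * √v' - √u' * √v) ^ 2 := by positivity
  linarith

theorem convex_feasibleSet {N : ℕ} (Λ : Set (Finset (Fin N))) (f : Finset (Fin N) → ℝ) :
    Convex ℝ (feasibleSet Λ f) := by
  intro F hF G hG a b ha hb hab
  refine ⟨fun n => ⟨?_, ?_⟩, fun y hy => ?_⟩
  · exact add_nonneg (mul_nonneg ha (hF.1 n).1) (mul_nonneg hb (hG.1 n).1)
  · have h1 := mul_le_mul_of_nonneg_left (hF.1 n).2 ha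
    have h2 := mul_le_mul_of_nonneg_left (hG.1 n).2 hb
    simp only [Pi.add_apply, Pi.smul_apply, smul_eq_mul]
    linarith
  · have h1 := mul_le_mul_of_nonneg_left (hF.2 y hy) ha
    have h2 := mul_le_mul_of_nonneg_left (hG.2 y hy) hb
    simp only [Pi.add_apply, Pi.smul_apply, smul_eq_mul, Finset.sum_add_distrib, ← Finset.mul_sum]
    have h3 : f y + (y.card : ℝ) - 1 = a * (f y + y.card - 1) + b * (f y + y.card - 1) := by
      rw [← add_mul, hab, one_mul]
    linarith

/-- Expanding `(∑ √(1 - F_n))²` as a double sum makes it a sum of geometric means of affine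
functions, hence concave; it enters with a negative sign beside a linear term. -/
theorem convexOn_tradeOff (hd : 2 ≤ d) {N : ℕ} (Λ : Set (Finset (Fin N)))
    (f : Finset (Fin N) → ℝ) : ConvexOn ℝ (feasibleSet Λ f) (tradeOff d) := by
  have hd' : (2 : ℝ) ≤ d := by exact_mod_cast hd
  refine ⟨convex_feasibleSet Λ f, fun F hF G hG a b ha hb hab => ?_⟩
  have key : a * (∑ n, √(1 - F n)) ^ 2 + b * (∑ n, √(1 - G n)) ^ 2 ≤
      (∑ n, √(1 - (a • F + b • G) n)) ^ 2 := by
    have h : ∀ n, 1 - (a • F + b • G) n = a * (1 - F n) + b * (1 - G n) := fun n => by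
      simp only [Pi.add_apply, Pi.smul_apply, smul_eq_mul]
      linear_combination -hab
    simp only [h, sq, Finset.sum_mul_sum]
    simp only [Finset.mul_sum, ← Finset.sum_add_distrib]
    exact Finset.sum_le_sum fun n _ => Finset.sum_le_sum fun m _ =>
      sqrt_mul_sqrt_concave ha hb (sub_nonneg.mpr (hF.1 n).2) (sub_nonneg.mpr (hG.1 n).2)
        (sub_nonneg.mpr (hF.1 m).2) (sub_nonneg.mpr (hG.1 m).2)
  have hc : (0 : ℝ) ≤ 1 / ((d : ℝ) - 1) := div_nonneg zero_le_one (by linarith)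
  have := mul_le_mul_of_nonneg_left key hc
  simp only [tradeOff, Pi.add_apply, Pi.smul_apply, smul_eq_mul, Finset.sum_add_distrib,
    ← Finset.mul_sum] at this ⊢
  linarith

theorem isCompact_feasibleSet {N : ℕ} (Λ : Set (Finset (Fin N))) (f : Finset (Fin N) → ℝ) :
    IsCompact (feasibleSet Λ f) := by
  have h : feasibleSet Λ f = Set.Icc 0 1 ∩
      ⋂ y ∈ Λ, {F : Fin N → ℝ | f y + (y.card : ℝ) - 1 ≤ ∑ n ∈ y, F n} := by
    ext F
    simp [feasibleSet, Pi.le_def, forall_and]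
  rw [h]
  exact isCompact_Icc.inter_right (isClosed_biInter fun y _ =>
    isClosed_le continuous_const (by fun_prop))

theorem achievable_iff (hd : 2 ≤ d) {M : ℕ} (Λ : Set (Finset (Fin (M + 1))))
    (f : Finset (Fin (M + 1)) → ℝ) : Achievable d M (M + 1) Λ f ↔
      ∃ v : ℝ, IsLeast (tradeOff d '' feasibleSet Λ f) v ∧ v ≤ (M : ℝ) := by
  have hd' : (2 : ℝ) ≤ d := by exact_mod_cast hd
  have hd0 : (0 : ℝ) < d := by linarith
  have hc : (0 : ℝ) < ((d : ℝ) - 1) / d := div_pos (by linarith) hd0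
  have hc1 : ((d : ℝ) - 1) / d ≤ 1 := (div_le_one hd0).mpr (by linarith)
  constructor
  · rintro ⟨E, hE, hEf⟩
    obtain ⟨β, hβ0, hβ, hle⟩ := hE.exists_normalised hd
    have hmem : (fun n => 1 - ((d : ℝ) - 1) / d * β n ^ 2) ∈ feasibleSet Λ f := by
      refine ⟨fun n => ⟨?_, ?_⟩, fun y hy => ?_⟩
      · have := mul_le_one₀ hc1 (sq_nonneg (β n)) (hβ.sq_le_one hd hβ0 n)
        linarith
      · have := mul_nonneg hc.le (sq_nonneg (β n))
        linarith
      · have := (hEf y hy).trans (hle y)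
        simp only [Finset.sum_sub_distrib, Finset.sum_const, nsmul_eq_mul, mul_one,
          ← Finset.mul_sum]
        linarith
    have hcont : Continuous (tradeOff d : (Fin (M + 1) → ℝ) → ℝ) := by
      unfold tradeOff
      fun_prop
    obtain ⟨v, hv⟩ := ((isCompact_feasibleSet Λ f).image hcont).exists_isLeast
      ⟨_, Set.mem_image_of_mem _ hmem⟩
    refine ⟨v, hv, (hv.2 (Set.mem_image_of_mem _ hmem)).trans ?_⟩
    have h := tradeOff_of_amplitudes hd hβ0
    rw [show _ = (d : ℝ) from hβ] at h
    have := mul_left_cancel₀ hd0.ne' ((mul_one (d : ℝ)).trans h)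
    linarith
  · rintro ⟨v, ⟨⟨F, hF, rfl⟩, -⟩, hv⟩
    obtain ⟨x, hx0, rfl⟩ := exists_amplitudes_of_le_one hd fun n => (hF.1 n).2
    -- Trade-off value at most `M` puts `x` at or above the threshold; shrinking to `β` can only
    -- raise the fidelities.
    obtain ⟨β, hβ0, hβ, hβx⟩ := exists_normalised_le hd hx0 (by
      rw [tradeOff_of_amplitudes hd hx0]
      nlinarith)
    obtain ⟨E, hE, -, hEF⟩ := exists_cloner_fidelity hd hβ
    refine ⟨E, hE, fun y hy => ?_⟩
    have h1 := hF.2 y hy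
    simp only [Finset.sum_sub_distrib, Finset.sum_const, nsmul_eq_mul, mul_one,
      ← Finset.mul_sum] at h1
    have h2 := mul_le_mul_of_nonneg_left
      (Finset.sum_le_sum fun n (_ : n ∈ y) => pow_le_pow_left₀ (hβ0 n) (hβx n) 2) hc.le
    rw [hEF]
    linarith

end TradeOff

end QClone

theorem mainTheorem2 (d M : ℕ) (hd : 2 ≤ d) :
    -- the number of outputs is N = M + 1; every normalised amplitude vector gives a cloner with these fidelities,
    -- optimal if the amplitudes are non-negative
    (∀ β : Fin (M + 1) → ℝ, QClone.Normalised d β →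
      ∃ E : QClone.Op d M →ₗ[ℂ] QClone.Op d (M + 1), QClone.IsChannel E ∧
        (∀ ψ : QClone.PureState d, E (QClone.copies M ψ.1) = QClone.clonerOutput β ψ.1) ∧
        (∀ y : Finset (Fin (M + 1)),
          QClone.fidelity E y = 1 - ((d : ℝ) - 1) / d * ∑ n ∈ y, β n ^ 2) ∧
        ((∀ n, 0 ≤ β n) → QClone.IsOptimalCloner E)) ∧
    -- every optimal cloner has fidelities of this form
    (∀ E : QClone.Op d M →ₗ[ℂ] QClone.Op d (M + 1), QClone.IsOptimalCloner E →
      (∃ β : Fin (M + 1) → ℝ, (∀ n, 0 ≤ β n) ∧ QClone.Normalised d β ∧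
        (∀ k, QClone.fidelity E {k} = 1 - ((d : ℝ) - 1) / d * β k ^ 2) ∧
        ∀ y : Finset (Fin (M + 1)),
          QClone.fidelity E y = 1 - ((d : ℝ) - 1) / d * ∑ n ∈ y, β n ^ 2) ∧
      ∀ y : Finset (Fin (M + 1)),
        QClone.fidelity E y = ∑ n ∈ y, QClone.fidelity E {n} - (y.card : ℝ) + 1) ∧
    -- the optimal trade-off between the single-copy fidelities
    (∀ F : Fin (M + 1) → ℝ,
      (∃ E : QClone.Op d M →ₗ[ℂ] QClone.Op d (M + 1), QClone.IsOptimalCloner E ∧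
        ∀ n, QClone.fidelity E {n} = F n) ↔
      (∀ n, F n ≤ 1) ∧ (M : ℝ) = QClone.tradeOff d F) ∧
    -- achievability of arbitrary targets as a convex minimisation
    (∀ (Λ : Set (Finset (Fin (M + 1)))) (f : Finset (Fin (M + 1)) → ℝ),
      ConvexOn ℝ (QClone.feasibleSet Λ f) (QClone.tradeOff d) ∧
      (QClone.Achievable d M (M + 1) Λ f ↔
        ∃ v : ℝ, IsLeast (QClone.tradeOff d '' QClone.feasibleSet Λ f) v ∧ v ≤ (M : ℝ))) := by
  refine ⟨fun β hβ => ?_, fun E hE => ?_, QClone.exists_isOptimalCloner_iff hd,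
    fun Λ f => ⟨QClone.convexOn_tradeOff hd Λ f, QClone.achievable_iff hd Λ f⟩⟩
  · obtain ⟨E, hE, hout, hF⟩ := QClone.exists_cloner_fidelity hd hβ
    exact ⟨E, hE, hout, hF, fun hβ0 => QClone.isOptimalCloner_of_fidelity hd hβ0 hβ hE
      fun n => by simpa using hF {n}⟩
  · obtain ⟨β, hβ0, hβ, hk, hy⟩ := hE.exists_normalised hd
    refine ⟨⟨β, hβ0, hβ, hk, hy⟩, fun y => ?_⟩
    simp only [hy, Finset.sum_singleton, Finset.sum_sub_distrib, Finset.sum_const,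
      nsmul_eq_mul, mul_one, ← Finset.mul_sum]
    ring
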